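/- Let $\Phi$ be a commutative unital ring containing $\frac12$, and let $V=(V^+,V^-)$ be a nondegenerate Jordan pair over $\Phi$ (that is, $Q_x=0$ implies $x=0$), with products $Q_xy$ and $\{x,y,z\}=Q_{x+z}y-Q_xy-Q_zy$. Let $TKK(V)=V^+\oplus \mathrm{IDer}\,V\oplus V^-$ be its Tits–Kantor–Koecher Lie algebra, where $\mathrm{IDer}\,V$ is the ideal of $\mathrm{Der}\,V$ generated by the inner derivations $\delta(x,y)=(D_{x,y},-D_{y,x})$. An ideal (of $V$ or of $TKK(V)$) is essential if it meets every nonzero ideal nontrivially. A permissible map $(f,I)$ of $L=TKK(V)$ is an additive map $f:I\to L$ on an essential ideal $I$ of $L$ with $f([x,y])=[x,f(y)]$ for all $x\in L$, $y\in I$. A permissible map $(g,U)$ of $V$ consists of an essential ideal $U=(U^+,U^-)$ of $V$ and linear maps $g^\sigma:U^\sigma\to V^\sigma$, $\sigma=\pm$, such that for all $u^{\pm\sigma}\in U^{\pm\sigma}$ and $x^{\sigma},z^{-\sigma}$ in $V^{\sigma},V^{-\sigma}$: $g^\sigma(Q_{x^\sigma}u^{-\sigma})=Q_{x^\sigma}g^{-\sigma}(u^{-\sigma})$;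 $g^\sigma(Q_{u^\sigma}z^{-\sigma})\in U^\sigma$ and $(g^\sigma)^2(Q_{u^\sigma}z^{-\sigma})=Q_{g^\sigma(u^\sigma)}z^{-\sigma}$; $g^\sigma(\{u^\sigma,z^{-\sigma},x^\sigma\})=\{g^\sigma(u^\sigma),z^{-\sigma},x^\sigma\}$. In both cases two permissible maps are equivalent if they agree on an essential ideal contained in both domains, and the extended centroids $\mathcal C(L)$ and $\mathcal C(V)$ are the rings of equivalence classes $\overline{(f,I)}$, respectively $[g,U]$, with addition $(f_1+f_2,\,I_1\cap I_2)$ and multiplication $(f_1f_2,\,f_2^{-1}(I_1))$ on representatives. Then for every permissible map $(f,I)$ of $TKK(V)$ (in particular whenever $I$ is a graded essential ideal) $f$ maps $I\cap V^\sigma$ into $V^\sigma$, $\sigma=\pm$, and its restriction $f_{I\cap V}$ to $I\cap V=(I\cap V^+,I\cap V^-)$ gives a permissible map $(f_{I\cap V},I\cap V)$ of $V$; and $$\Psi:\mathcal C(TKK(V))\to\mathcal C(V),\qquad \overline{(f,I)}\mapsto[f_{I\cap V},\,I\cap V],$$ is a well-defined isomorphism of rings. -/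

import Mathlib

/-! ### Jordan pairs -/

section JordanPairs

variable {Φ Vp Vm : Type*} [CommRing Φ] [AddCommGroup Vp] [Module Φ Vp]
  [AddCommGroup Vm] [Module Φ Vm]

/-- The trilinear product `{x, y, z} = D_{x,y} z = Q_{x+z} y - Q_x y - Q_z y` obtained from a
quadratic map `x ↦ Q_x` by linearization. -/
def jordanTriple (Q : QuadraticMap Φ Vp (Vm →ₗ[Φ] Vp)) : Vp →ₗ[Φ] Vm →ₗ[Φ] Vp →ₗ[Φ] Vp :=
  LinearMap.lflip.toLinearMap ∘ₗ Q.polarBilin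

theorem jordanTriple_apply (Q : QuadraticMap Φ Vp (Vm →ₗ[Φ] Vp)) (x : Vp) (y : Vm) (z : Vp) :
    jordanTriple Q x y z = Q (x + z) y - Q x y - Q z y := by
  simp [jordanTriple, QuadraticMap.polar]

theorem jordanTriple_comm (Q : QuadraticMap Φ Vp (Vm →ₗ[Φ] Vp)) (x : Vp) (y : Vm) (z : Vp) :
    jordanTriple Q x y z = jordanTriple Q z y x := by
  rw [jordanTriple_apply, jordanTriple_apply, add_comm x z]; abel

theorem jordanTriple_self (Q : QuadraticMap Φ Vp (Vm →ₗ[Φ] Vp)) (x : Vp) (y : Vm) :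
    jordanTriple Q x y x = (2 : Φ) • Q x y := by
  rw [jordanTriple_apply, ← two_smul Φ x, QuadraticMap.map_smul, two_smul]
  simp only [LinearMap.smul_apply]
  rw [mul_smul, two_smul, two_smul]; abel

/-- One half (one value of the sign `σ`) of the axioms of a Jordan pair: the identities
* `D(x,y) Q_x = Q_x D(y,x)`,
* `D(Q_x y, y) = D(x, Q_y x)`,
* `Q_{Q_x y} = Q_x Q_y Q_x`,

required to hold in all scalar extensions. Strictness is expressed by listing the homogeneous
components in `x` of the linearizations which do not follow from the identities themselves by
subtraction: the component linear in `w` after `x ↦ x + w`, of the first identity (cubic in `x`)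
and of the third one (quartic in `x`). -/
structure JordanPairIdentities (Q : QuadraticMap Φ Vp (Vm →ₗ[Φ] Vp))
    (Q' : QuadraticMap Φ Vm (Vp →ₗ[Φ] Vm)) : Prop where
  jp1 : ∀ (x : Vp) (y z : Vm),
    jordanTriple Q x y (Q x z) = Q x (jordanTriple Q' y x z)
  jp1_lin : ∀ (x w : Vp) (y z : Vm),
    jordanTriple Q w y (Q x z) + jordanTriple Q x y (jordanTriple Q x z w) =
      jordanTriple Q x (jordanTriple Q' y x z) w + Q x (jordanTriple Q' y w z)
  jp2 : ∀ (x : Vp) (y : Vm) (z : Vp),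
    jordanTriple Q (Q x y) y z = jordanTriple Q x (Q' y x) z
  jp3 : ∀ (x : Vp) (y z : Vm), Q (Q x y) z = Q x (Q' y (Q x z))
  jp3_lin : ∀ (x w : Vp) (y z : Vm),
    jordanTriple Q (Q x y) z (jordanTriple Q x y w) =
      jordanTriple Q x (Q' y (Q x z)) w + Q x (Q' y (jordanTriple Q x z w))

variable (Φ Vp Vm) in
/-- A Jordan pair structure on the pair of `Φ`-modules `(V⁺, V⁻) = (Vp, Vm)`. -/
structure JordanPair where
  /-- `Qp x y = Q_x y` for `x ∈ V⁺`, `y ∈ V⁻`. -/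
  Qp : QuadraticMap Φ Vp (Vm →ₗ[Φ] Vp)
  /-- `Qm y x = Q_y x` for `y ∈ V⁻`, `x ∈ V⁺`. -/
  Qm : QuadraticMap Φ Vm (Vp →ₗ[Φ] Vm)
  ids_pos : JordanPairIdentities Qp Qm
  ids_neg : JordanPairIdentities Qm Qp

end JordanPairs

namespace JordanPair

variable {Φ Vp Vm : Type*} [CommRing Φ] [AddCommGroup Vp] [Module Φ Vp]
  [AddCommGroup Vm] [Module Φ Vm]

/-- `{x, y, z}` for `x, z ∈ V⁺`, `y ∈ V⁻`. -/
abbrev Tp (J : JordanPair Φ Vp Vm) : Vp →ₗ[Φ] Vm →ₗ[Φ] Vp →ₗ[Φ] Vp := jordanTriple J.Qp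

/-- `{y, x, v}` for `y, v ∈ V⁻`, `x ∈ V⁺`. -/
abbrev Tm (J : JordanPair Φ Vp Vm) : Vm →ₗ[Φ] Vp →ₗ[Φ] Vm →ₗ[Φ] Vm := jordanTriple J.Qm

/-- A Jordan pair is nondegenerate if it has no nonzero absolute zero divisors:
`Q_x = 0` implies `x = 0`. -/
class IsNondegenerate (J : JordanPair Φ Vp Vm) : Prop where
  pos : ∀ x : Vp, J.Qp x = 0 → x = 0
  neg : ∀ y : Vm, J.Qm y = 0 → y = 0

/-! #### Ideals of a Jordan pair -/

/-- An ideal `U = (U⁺, U⁻)` of a Jordan pair: submodules with `Q_{U^σ} V^{-σ} ⊆ U^σ`,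
`Q_{V^σ} U^{-σ} ⊆ U^σ` and `{V^σ, V^{-σ}, U^σ} ⊆ U^σ`. -/
@[ext]
structure Ideal (J : JordanPair Φ Vp Vm) where
  pos : Submodule Φ Vp
  neg : Submodule Φ Vm
  inner_pos : ∀ u ∈ pos, ∀ y : Vm, J.Qp u y ∈ pos
  inner_neg : ∀ u ∈ neg, ∀ x : Vp, J.Qm u x ∈ neg
  outer_pos : ∀ (x : Vp), ∀ u ∈ neg, J.Qp x u ∈ pos
  outer_neg : ∀ (y : Vm), ∀ u ∈ pos, J.Qm y u ∈ neg
  triple_pos : ∀ (x : Vp) (y : Vm), ∀ u ∈ pos, J.Tp x y u ∈ pos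
  triple_neg : ∀ (y : Vm) (x : Vp), ∀ u ∈ neg, J.Tm y x u ∈ neg

namespace Ideal

variable {J : JordanPair Φ Vp Vm}

/-- The zero ideal. -/
instance : Bot J.Ideal where
  bot :=
    { pos := ⊥, neg := ⊥
      inner_pos := by simp
      inner_neg := by simp
      outer_pos := by simp
      outer_neg := by simp
      triple_pos := by simp
      triple_neg := by simp }

/-- The ideal `V`. -/
instance : Top J.Ideal where
  top :=
    { pos := ⊤, neg := ⊤
      inner_pos := by simp
      inner_neg := by simp
      outer_pos := by simp
      outer_neg := by simp
      triple_pos := by simp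
      triple_neg := by simp }

/-- The intersection `U ∩ K = (U⁺ ∩ K⁺, U⁻ ∩ K⁻)`. -/
instance : Min J.Ideal where
  min U K :=
    { pos := U.pos ⊓ K.pos, neg := U.neg ⊓ K.neg
      inner_pos := fun u hu y => ⟨U.inner_pos u hu.1 y, K.inner_pos u hu.2 y⟩
      inner_neg := fun u hu y => ⟨U.inner_neg u hu.1 y, K.inner_neg u hu.2 y⟩
      outer_pos := fun x u hu => ⟨U.outer_pos x u hu.1, K.outer_pos x u hu.2⟩
      outer_neg := fun x u hu => ⟨U.outer_neg x u hu.1, K.outer_neg x u hu.2⟩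
      triple_pos := fun x y u hu => ⟨U.triple_pos x y u hu.1, K.triple_pos x y u hu.2⟩
      triple_neg := fun x y u hu => ⟨U.triple_neg x y u hu.1, K.triple_neg x y u hu.2⟩ }

@[simp] theorem bot_pos : (⊥ : J.Ideal).pos = ⊥ := rfl
@[simp] theorem bot_neg : (⊥ : J.Ideal).neg = ⊥ := rfl
@[simp] theorem top_pos : (⊤ : J.Ideal).pos = ⊤ := rfl
@[simp] theorem top_neg : (⊤ : J.Ideal).neg = ⊤ := rfl
@[simp] theorem inf_pos (U K : J.Ideal) : (U ⊓ K).pos = U.pos ⊓ K.pos := rfl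
@[simp] theorem inf_neg (U K : J.Ideal) : (U ⊓ K).neg = U.neg ⊓ K.neg := rfl

/-- An ideal is essential if it has nonzero intersection with every nonzero ideal. -/
def IsEssential (U : J.Ideal) : Prop := ∀ K : J.Ideal, K ≠ ⊥ → U ⊓ K ≠ ⊥

theorem ext_mem {U K : J.Ideal} (hp : ∀ x, x ∈ U.pos ↔ x ∈ K.pos)
    (hn : ∀ y, y ∈ U.neg ↔ y ∈ K.neg) : U = K :=
  Ideal.ext (Submodule.ext hp) (Submodule.ext hn)

theorem isEssential_top : (⊤ : J.Ideal).IsEssential := by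
  intro K hK h
  exact hK (h ▸ ext_mem (by simp) (by simp))

theorem IsEssential.inf {U W : J.Ideal} (hU : U.IsEssential) (hW : W.IsEssential) :
    (U ⊓ W).IsEssential := by
  intro K hK h
  refine hU _ (hW K hK) ?_
  rw [← h]
  exact ext_mem (by simp [and_assoc]) (by simp [and_assoc])

end Ideal

/-! #### `V`-homomorphisms and the extended centroid of a Jordan pair -/

/-- The set `Hom_V(U, V)` of `V`-homomorphisms `g = (g⁺, g⁻)` from the ideal `U` into `V`. -/
structure VHom (J : JordanPair Φ Vp Vm) (U : J.Ideal) where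
  gp : U.pos →ₗ[Φ] Vp
  gm : U.neg →ₗ[Φ] Vm
  /-- `g(Q_x y) = Q_x g(y)` -/
  outer_pos : ∀ (x : Vp) (y : U.neg), gp ⟨J.Qp x y, U.outer_pos x y y.2⟩ = J.Qp x (gm y)
  outer_neg : ∀ (y : Vm) (x : U.pos), gm ⟨J.Qm y x, U.outer_neg y x x.2⟩ = J.Qm y (gp x)
  /-- `g(Q_y x) ∈ U` for `y ∈ U` -/
  inner_mem_pos : ∀ (y : U.pos) (x : Vm), gp ⟨J.Qp y x, U.inner_pos y y.2 x⟩ ∈ U.pos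
  inner_mem_neg : ∀ (y : U.neg) (x : Vp), gm ⟨J.Qm y x, U.inner_neg y y.2 x⟩ ∈ U.neg
  /-- `g²(Q_y x) = Q_{g(y)} x` for `y ∈ U` -/
  inner_pos : ∀ (y : U.pos) (x : Vm), gp ⟨_, inner_mem_pos y x⟩ = J.Qp (gp y) x
  inner_neg : ∀ (y : U.neg) (x : Vp), gm ⟨_, inner_mem_neg y x⟩ = J.Qm (gm y) x
  /-- `g({y, z, x}) = {g(y), z, x}` -/
  triple_pos : ∀ (y : U.pos) (z : Vm) (x : Vp),
    gp ⟨J.Tp y z x, by rw [jordanTriple_comm]; exact U.triple_pos x z y y.2⟩ = J.Tp (gp y) z x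
  triple_neg : ∀ (y : U.neg) (z : Vp) (x : Vm),
    gm ⟨J.Tm y z x, by rw [jordanTriple_comm]; exact U.triple_neg x z y y.2⟩ = J.Tm (gm y) z x

/-- When `1/2 ∈ Φ`, the conditions on `g(Q_y x)`, `y ∈ U`, follow from the other ones. -/
def VHom.mk' [Invertible (2 : Φ)] (J : JordanPair Φ Vp Vm) (U : J.Ideal)
    (gp : U.pos →ₗ[Φ] Vp) (gm : U.neg →ₗ[Φ] Vm)
    (outer_pos : ∀ (x : Vp) (y : U.neg),
      gp ⟨J.Qp x y, U.outer_pos x y y.2⟩ = J.Qp x (gm y))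
    (outer_neg : ∀ (y : Vm) (x : U.pos),
      gm ⟨J.Qm y x, U.outer_neg y x x.2⟩ = J.Qm y (gp x))
    (triple_pos : ∀ (y : U.pos) (z : Vm) (x : Vp),
      gp ⟨J.Tp y z x, by rw [jordanTriple_comm]; exact U.triple_pos x z y y.2⟩ =
        J.Tp (gp y) z x)
    (triple_neg : ∀ (y : U.neg) (z : Vp) (x : Vm),
      gm ⟨J.Tm y z x, by rw [jordanTriple_comm]; exact U.triple_neg x z y y.2⟩ =
        J.Tm (gm y) z x) : J.VHom U :=
  have kp : ∀ (y : U.pos) (x : Vm), gp ⟨J.Qp y x, U.inner_pos y y.2 x⟩ =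
      (⅟2 : Φ) • J.Tp (gp y) x y := by
    intro y x
    rw [← triple_pos, ← map_smul]
    congr 1
    ext
    simp [jordanTriple_self, smul_smul]
  have km : ∀ (y : U.neg) (x : Vp), gm ⟨J.Qm y x, U.inner_neg y y.2 x⟩ =
      (⅟2 : Φ) • J.Tm (gm y) x y := by
    intro y x
    rw [← triple_neg, ← map_smul]
    congr 1
    ext
    simp [jordanTriple_self, smul_smul]
  { gp, gm, outer_pos, outer_neg, triple_pos, triple_neg
    inner_mem_pos := fun y x => by
      rw [kp]; exact U.pos.smul_mem _ (U.triple_pos _ _ _ y.2)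
    inner_mem_neg := fun y x => by
      rw [km]; exact U.neg.smul_mem _ (U.triple_neg _ _ _ y.2)
    inner_pos := fun y x => by
      have h := triple_pos y x (gp y)
      rw [jordanTriple_self] at h
      have h2 : J.Qp (gp y) x = (⅟2 : Φ) • (2 : Φ) • J.Qp (gp y) x := by simp [smul_smul]
      rw [h2, ← h]
      refine Eq.trans ?_ (gp.map_smul _ _)
      congr 1
      ext
      simp only [kp, SetLike.val_smul]
      rw [jordanTriple_comm]
    inner_neg := fun y x => by
      have h := triple_neg y x (gm y)
      rw [jordanTriple_self] at h
      have h2 : J.Qm (gm y) x = (⅟2 : Φ) • (2 : Φ) • J.Qm (gm y) x := by simp [smul_smul]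
      rw [h2, ← h]
      refine Eq.trans ?_ (gm.map_smul _ _)
      congr 1
      ext
      simp only [km, SetLike.val_smul]
      rw [jordanTriple_comm] }

theorem VHom.gp_inner [Invertible (2 : Φ)] {J : JordanPair Φ Vp Vm} {U : J.Ideal} (g : J.VHom U)
    (u : U.pos) (y : Vm) :
    g.gp ⟨J.Qp u y, U.inner_pos u u.2 y⟩ = (⅟2 : Φ) • J.Tp (g.gp u) y u := by
  rw [← g.triple_pos, ← map_smul]
  congr 1
  ext
  simp [jordanTriple_self, smul_smul]

theorem VHom.gm_inner [Invertible (2 : Φ)] {J : JordanPair Φ Vp Vm} {U : J.Ideal} (g : J.VHom U)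
    (u : U.neg) (x : Vp) :
    g.gm ⟨J.Qm u x, U.inner_neg u u.2 x⟩ = (⅟2 : Φ) • J.Tm (g.gm u) x u := by
  rw [← g.triple_neg, ← map_smul]
  congr 1
  ext
  simp [jordanTriple_self, smul_smul]

/-- The ideal `g⁻¹(W) = {u ∈ U | g(u) ∈ W}`, for a `V`-homomorphism `g` on `U`. -/
def VHom.preimage [Invertible (2 : Φ)] {J : JordanPair Φ Vp Vm} {U : J.Ideal} (g : J.VHom U)
    (W : J.Ideal) : J.Ideal where
  pos :=
    { carrier := {u | ∃ h : u ∈ U.pos, g.gp ⟨u, h⟩ ∈ W.pos}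
      zero_mem' := ⟨U.pos.zero_mem, by
        rw [show (⟨0, U.pos.zero_mem⟩ : U.pos) = 0 from rfl, map_zero]; exact W.pos.zero_mem⟩
      add_mem' := fun {x y} ⟨h, h'⟩ ⟨k, k'⟩ => ⟨U.pos.add_mem h k, by
        rw [← AddMemClass.mk_add_mk _ _ _ h k, map_add]; exact W.pos.add_mem h' k'⟩
      smul_mem' := fun c x ⟨h, h'⟩ => ⟨U.pos.smul_mem c h, by
        rw [← SetLike.mk_smul_mk _ c _ h, map_smul]; exact W.pos.smul_mem c h'⟩ }
  neg :=
    { carrier := {u | ∃ h : u ∈ U.neg, g.gm ⟨u, h⟩ ∈ W.neg}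
      zero_mem' := ⟨U.neg.zero_mem, by
        rw [show (⟨0, U.neg.zero_mem⟩ : U.neg) = 0 from rfl, map_zero]; exact W.neg.zero_mem⟩
      add_mem' := fun {x y} ⟨h, h'⟩ ⟨k, k'⟩ => ⟨U.neg.add_mem h k, by
        rw [← AddMemClass.mk_add_mk _ _ _ h k, map_add]; exact W.neg.add_mem h' k'⟩
      smul_mem' := fun c x ⟨h, h'⟩ => ⟨U.neg.smul_mem c h, by
        rw [← SetLike.mk_smul_mk _ c _ h, map_smul]; exact W.neg.smul_mem c h'⟩ }
  inner_pos := fun u ⟨h, h'⟩ y => ⟨U.inner_pos u h y, by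
    rw [g.gp_inner ⟨u, h⟩, jordanTriple_comm]
    exact W.pos.smul_mem _ (W.triple_pos _ _ _ h')⟩
  inner_neg := fun u ⟨h, h'⟩ y => ⟨U.inner_neg u h y, by
    rw [g.gm_inner ⟨u, h⟩, jordanTriple_comm]
    exact W.neg.smul_mem _ (W.triple_neg _ _ _ h')⟩
  outer_pos := fun x u ⟨h, h'⟩ => ⟨U.outer_pos x u h, by
    rw [g.outer_pos x ⟨u, h⟩]; exact W.outer_pos _ _ h'⟩
  outer_neg := fun x u ⟨h, h'⟩ => ⟨U.outer_neg x u h, by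
    rw [g.outer_neg x ⟨u, h⟩]; exact W.outer_neg _ _ h'⟩
  triple_pos := fun x y u ⟨h, h'⟩ => ⟨U.triple_pos x y u h, by
    have := g.triple_pos ⟨u, h⟩ y x
    simp only [jordanTriple_comm J.Qp _ y x] at this
    rw [this]; exact W.triple_pos _ _ _ h'⟩
  triple_neg := fun x y u ⟨h, h'⟩ => ⟨U.triple_neg x y u h, by
    have := g.triple_neg ⟨u, h⟩ y x
    simp only [jordanTriple_comm J.Qm _ y x] at this
    rw [this]; exact W.triple_neg _ _ _ h'⟩

theorem VHom.preimage_isEssential [Invertible (2 : Φ)] {J : JordanPair Φ Vp Vm}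
    [J.IsNondegenerate] {U : J.Ideal} (g : J.VHom U) {W : J.Ideal} (hU : U.IsEssential)
    (hW : W.IsEssential) : (g.preimage W).IsEssential := by
  intro K hK h
  apply hW _ (hU K hK)
  have hp : ∀ u ∈ (W ⊓ (U ⊓ K)).pos, u = 0 := by
    rintro u ⟨h1, h2, h3⟩
    apply IsNondegenerate.pos (J := J)
    ext y
    have : J.Qp u y ∈ (g.preimage W ⊓ K).pos := by
      refine ⟨⟨U.inner_pos u h2 y, ?_⟩, K.inner_pos u h3 y⟩
      rw [g.gp_inner ⟨u, h2⟩]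
      exact W.pos.smul_mem _ (W.triple_pos _ _ _ h1)
    rw [h] at this
    simpa using this
  have hn : ∀ u ∈ (W ⊓ (U ⊓ K)).neg, u = 0 := by
    rintro u ⟨h1, h2, h3⟩
    apply IsNondegenerate.neg (J := J)
    ext y
    have : J.Qm u y ∈ (g.preimage W ⊓ K).neg := by
      refine ⟨⟨U.inner_neg u h2 y, ?_⟩, K.inner_neg u h3 y⟩
      rw [g.gm_inner ⟨u, h2⟩]
      exact W.neg.smul_mem _ (W.triple_neg _ _ _ h1)
    rw [h] at this
    simpa using this
  exact Ideal.ext ((Submodule.eq_bot_iff _).2 hp) ((Submodule.eq_bot_iff _).2 hn)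

/-- A permissible map `(g, U)`: a `V`-homomorphism on an essential ideal `U`. -/
structure Permissible (J : JordanPair Φ Vp Vm) where
  dom : J.Ideal
  essential : dom.IsEssential
  map : J.VHom dom

namespace Permissible

variable {J : JordanPair Φ Vp Vm}

/-- Two permissible maps are equivalent if they agree on an essential ideal contained in both
domains. -/
def Rel (a b : J.Permissible) : Prop :=
  ∃ U : J.Ideal, U.IsEssential ∧
    (∀ x ∈ U.pos, ∃ (ha : x ∈ a.dom.pos) (hb : x ∈ b.dom.pos), a.map.gp ⟨x, ha⟩ = b.map.gp ⟨x, hb⟩) ∧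
    (∀ y ∈ U.neg, ∃ (ha : y ∈ a.dom.neg) (hb : y ∈ b.dom.neg), a.map.gm ⟨y, ha⟩ = b.map.gm ⟨y, hb⟩)

theorem rel_of_agree {a b : J.Permissible}
    (hp : ∀ x (ha : x ∈ a.dom.pos) (hb : x ∈ b.dom.pos), a.map.gp ⟨x, ha⟩ = b.map.gp ⟨x, hb⟩)
    (hm : ∀ y (ha : y ∈ a.dom.neg) (hb : y ∈ b.dom.neg), a.map.gm ⟨y, ha⟩ = b.map.gm ⟨y, hb⟩) :
    Rel a b :=
  ⟨a.dom ⊓ b.dom, a.essential.inf b.essential,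
    fun x hx => ⟨hx.1, hx.2, hp x _ _⟩, fun y hy => ⟨hy.1, hy.2, hm y _ _⟩⟩

instance setoid (J : JordanPair Φ Vp Vm) : Setoid J.Permissible where
  r := Rel
  iseqv :=
    { refl := fun a => rel_of_agree (fun _ _ _ => rfl) (fun _ _ _ => rfl)
      symm := fun ⟨U, hU, hp, hm⟩ => ⟨U, hU,
        fun x hx => by obtain ⟨h, h', e⟩ := hp x hx; exact ⟨h', h, e.symm⟩,
        fun x hx => by obtain ⟨h, h', e⟩ := hm x hx; exact ⟨h', h, e.symm⟩⟩
      trans := fun ⟨U, hU, hp, hm⟩ ⟨W, hW, kp, km⟩ => ⟨U ⊓ W, hU.inf hW,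
        fun x hx => by
          obtain ⟨h, _, e⟩ := hp x hx.1
          obtain ⟨_, k, e'⟩ := kp x hx.2
          exact ⟨h, k, e.trans e'⟩,
        fun x hx => by
          obtain ⟨h, _, e⟩ := hm x hx.1
          obtain ⟨_, k, e'⟩ := km x hx.2
          exact ⟨h, k, e.trans e'⟩⟩ }

variable [Invertible (2 : Φ)]

instance : Zero J.Permissible where
  zero := ⟨⊤, Ideal.isEssential_top, VHom.mk' J ⊤ 0 0 (by simp) (by simp) (by simp) (by simp)⟩

/-- The identity of `V`. -/
instance : One J.Permissible where
  one := ⟨⊤, Ideal.isEssential_top,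
    VHom.mk' J ⊤ (Submodule.subtype _) (Submodule.subtype _)
      (by simp) (by simp) (by simp) (by simp)⟩

instance : Neg J.Permissible where
  neg a := ⟨a.dom, a.essential, VHom.mk' J a.dom (-a.map.gp) (-a.map.gm)
    (fun x y => by simp [a.map.outer_pos])
    (fun x y => by simp [a.map.outer_neg])
    (fun x y z => by simp [a.map.triple_pos])
    (fun x y z => by simp [a.map.triple_neg])⟩

/-- The sum `(g₁ + g₂, U₁ ∩ U₂)`. -/
instance : Add J.Permissible where
  add a b := ⟨a.dom ⊓ b.dom, a.essential.inf b.essential,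
    VHom.mk' J (a.dom ⊓ b.dom)
      (a.map.gp ∘ₗ Submodule.inclusion inf_le_left + b.map.gp ∘ₗ Submodule.inclusion inf_le_right)
      (a.map.gm ∘ₗ Submodule.inclusion inf_le_left + b.map.gm ∘ₗ Submodule.inclusion inf_le_right)
      (fun x y => by
        simp only [LinearMap.add_apply, map_add]
        exact congrArg₂ (· + ·) (a.map.outer_pos x ⟨y, y.2.1⟩) (b.map.outer_pos x ⟨y, y.2.2⟩))
      (fun x y => by
        simp only [LinearMap.add_apply, map_add]
        exact congrArg₂ (· + ·) (a.map.outer_neg x ⟨y, y.2.1⟩) (b.map.outer_neg x ⟨y, y.2.2⟩))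
      (fun y z x => by
        simp only [LinearMap.add_apply, map_add]
        exact
          congrArg₂ (· + ·) (a.map.triple_pos ⟨y, y.2.1⟩ z x) (b.map.triple_pos ⟨y, y.2.2⟩ z x))
      (fun y z x => by
        simp only [LinearMap.add_apply, map_add]
        exact
          congrArg₂ (· + ·) (a.map.triple_neg ⟨y, y.2.1⟩ z x) (b.map.triple_neg ⟨y, y.2.2⟩ z x))⟩

/-- The product `(g₁ g₂, g₂⁻¹(U₁))`, given by composition. -/
instance [J.IsNondegenerate] : Mul J.Permissible where
  mul a b := ⟨b.map.preimage a.dom, b.map.preimage_isEssential b.essential a.essential,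
    VHom.mk' J (b.map.preimage a.dom)
      { toFun := fun x => a.map.gp ⟨b.map.gp ⟨x, x.2.fst⟩, x.2.snd⟩
        map_add' := fun x y => by
          rw [← map_add]; congr 1; ext
          exact map_add b.map.gp ⟨x, x.2.fst⟩ ⟨y, y.2.fst⟩
        map_smul' := fun c x => by
          rw [RingHom.id_apply, ← map_smul]; congr 1; ext
          exact map_smul b.map.gp c ⟨x, x.2.fst⟩ }
      { toFun := fun x => a.map.gm ⟨b.map.gm ⟨x, x.2.fst⟩, x.2.snd⟩
        map_add' := fun x y => by
          rw [← map_add]; congr 1; ext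
          exact map_add b.map.gm ⟨x, x.2.fst⟩ ⟨y, y.2.fst⟩
        map_smul' := fun c x => by
          rw [RingHom.id_apply, ← map_smul]; congr 1; ext
          exact map_smul b.map.gm c ⟨x, x.2.fst⟩ }
      (fun x y => (congrArg a.map.gp (Subtype.ext (b.map.outer_pos x ⟨y, y.2.fst⟩))).trans
        (a.map.outer_pos x ⟨_, y.2.snd⟩))
      (fun x y => (congrArg a.map.gm (Subtype.ext (b.map.outer_neg x ⟨y, y.2.fst⟩))).trans
        (a.map.outer_neg x ⟨_, y.2.snd⟩))
      (fun y z x => (congrArg a.map.gp (Subtype.ext (b.map.triple_pos ⟨y, y.2.fst⟩ z x))).trans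
        (a.map.triple_pos ⟨_, y.2.snd⟩ z x))
      (fun y z x => (congrArg a.map.gm (Subtype.ext (b.map.triple_neg ⟨y, y.2.fst⟩ z x))).trans
        (a.map.triple_neg ⟨_, y.2.snd⟩ z x))⟩

theorem rel_add {a a' b b' : J.Permissible} (h : Rel a a') (k : Rel b b') :
    Rel (a + b) (a' + b') := by
  obtain ⟨U, hU, hp, hm⟩ := h
  obtain ⟨W, hW, kp, km⟩ := k
  refine ⟨U ⊓ W, hU.inf hW, fun x hx => ?_, fun x hx => ?_⟩
  · obtain ⟨h1, h2, e⟩ := hp x hx.1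
    obtain ⟨k1, k2, e'⟩ := kp x hx.2
    exact ⟨⟨h1, k1⟩, ⟨h2, k2⟩, congrArg₂ (· + ·) e e'⟩
  · obtain ⟨h1, h2, e⟩ := hm x hx.1
    obtain ⟨k1, k2, e'⟩ := km x hx.2
    exact ⟨⟨h1, k1⟩, ⟨h2, k2⟩, congrArg₂ (· + ·) e e'⟩

theorem rel_neg {a a' : J.Permissible} (h : Rel a a') : Rel (-a) (-a') := by
  obtain ⟨U, hU, hp, hm⟩ := h
  refine ⟨U, hU, fun x hx => ?_, fun x hx => ?_⟩
  · obtain ⟨h1, h2, e⟩ := hp x hx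
    exact ⟨h1, h2, congrArg (-·) e⟩
  · obtain ⟨h1, h2, e⟩ := hm x hx
    exact ⟨h1, h2, congrArg (-·) e⟩

theorem rel_mul [J.IsNondegenerate] {a a' b b' : J.Permissible} (h : Rel a a') (k : Rel b b') :
    Rel (a * b) (a' * b') := by
  obtain ⟨U, hU, hp, hm⟩ := h
  obtain ⟨W, hW, kp, km⟩ := k
  refine ⟨b.map.preimage U ⊓ W, (b.map.preimage_isEssential b.essential hU).inf hW,
    fun x hx => ?_, fun x hx => ?_⟩
  · obtain ⟨k1, k2, e'⟩ := kp x hx.2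
    obtain ⟨h1, h2, e⟩ := hp _ hx.1.snd
    exact ⟨⟨k1, h1⟩, ⟨k2, e' ▸ h2⟩, e.trans (congrArg a'.map.gp (Subtype.ext e'))⟩
  · obtain ⟨k1, k2, e'⟩ := km x hx.2
    obtain ⟨h1, h2, e⟩ := hm _ hx.1.snd
    exact ⟨⟨k1, h1⟩, ⟨k2, e' ▸ h2⟩, e.trans (congrArg a'.map.gm (Subtype.ext e'))⟩

end Permissible

/-- The extended centroid `C(V)` of a Jordan pair `V`: classes `[g, U]` of permissible maps. -/
def ExtendedCentroid (J : JordanPair Φ Vp Vm) : Type _ := Quotient (Permissible.setoid J)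

/-- The class `[g, U]` of a permissible map. -/
def ExtendedCentroid.mk {J : JordanPair Φ Vp Vm} (a : J.Permissible) : J.ExtendedCentroid :=
  Quotient.mk _ a

namespace ExtendedCentroid

open Permissible

variable [Invertible (2 : Φ)] {J : JordanPair Φ Vp Vm}

instance : Zero J.ExtendedCentroid := ⟨mk 0⟩
instance : One J.ExtendedCentroid := ⟨mk 1⟩
instance : Add J.ExtendedCentroid := ⟨Quotient.map₂ (· + ·) (fun _ _ h _ _ k => rel_add h k)⟩
instance : Neg J.ExtendedCentroid := ⟨Quotient.map (- ·) (fun _ _ h => rel_neg h)⟩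
instance [J.IsNondegenerate] : Mul J.ExtendedCentroid :=
  ⟨Quotient.map₂ (· * ·) (fun _ _ h _ _ k => rel_mul h k)⟩

/-- The ring structure of the extended centroid of a nondegenerate Jordan pair: addition of
representatives on the intersection of their domains, and composition of representatives on the
preimage of the domain. -/
instance instRing [J.IsNondegenerate] : Ring J.ExtendedCentroid where
  nsmul := nsmulRec
  zsmul := zsmulRec
  add_assoc := by
    rintro ⟨a⟩ ⟨b⟩ ⟨c⟩
    exact Quotient.sound (rel_of_agree (fun _ _ _ => add_assoc _ _ _) (fun _ _ _ => add_assoc _ _ _))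
  zero_add := by
    rintro ⟨a⟩
    exact Quotient.sound (rel_of_agree (fun _ _ _ => zero_add _) (fun _ _ _ => zero_add _))
  add_zero := by
    rintro ⟨a⟩
    exact Quotient.sound (rel_of_agree (fun _ _ _ => add_zero _) (fun _ _ _ => add_zero _))
  add_comm := by
    rintro ⟨a⟩ ⟨b⟩
    exact Quotient.sound (rel_of_agree (fun _ _ _ => add_comm _ _) (fun _ _ _ => add_comm _ _))
  neg_add_cancel := by
    rintro ⟨a⟩
    exact Quotient.sound
      (rel_of_agree (fun _ _ _ => neg_add_cancel _) (fun _ _ _ => neg_add_cancel _))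
  mul_assoc := by
    rintro ⟨a⟩ ⟨b⟩ ⟨c⟩
    exact Quotient.sound (rel_of_agree (fun _ _ _ => rfl) (fun _ _ _ => rfl))
  one_mul := by
    rintro ⟨a⟩
    exact Quotient.sound (rel_of_agree (fun _ _ _ => rfl) (fun _ _ _ => rfl))
  mul_one := by
    rintro ⟨a⟩
    exact Quotient.sound (rel_of_agree (fun _ _ _ => rfl) (fun _ _ _ => rfl))
  zero_mul := by
    rintro ⟨a⟩
    exact Quotient.sound (rel_of_agree (fun _ _ _ => rfl) (fun _ _ _ => rfl))
  mul_zero := by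
    rintro ⟨a⟩
    exact Quotient.sound
      (rel_of_agree (fun _ _ _ => map_zero a.map.gp) (fun _ _ _ => map_zero a.map.gm))
  left_distrib := by
    rintro ⟨a⟩ ⟨b⟩ ⟨c⟩
    exact Quotient.sound (rel_of_agree
      (fun _ _ h => map_add a.map.gp ⟨_, h.1.snd⟩ ⟨_, h.2.snd⟩)
      (fun _ _ h => map_add a.map.gm ⟨_, h.1.snd⟩ ⟨_, h.2.snd⟩))
  right_distrib := by
    rintro ⟨a⟩ ⟨b⟩ ⟨c⟩
    exact Quotient.sound (rel_of_agree (fun _ _ _ => rfl) (fun _ _ _ => rfl))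

end ExtendedCentroid

end JordanPair

/-! ### The extended centroid of a semiprime Lie algebra -/

section LieCentroid

variable (Φ L : Type*) [CommRing Φ] [LieRing L] [LieAlgebra Φ L]

/-- A Lie algebra is semiprime if it has no nonzero ideal `I` with `[I, I] = 0`. -/
class IsSemiprimeLie : Prop where
  eq_bot : ∀ I : LieIdeal Φ L, (∀ x ∈ I, ∀ y ∈ I, ⁅x, y⁆ = 0) → I = ⊥

variable {Φ L}

/-- An ideal is essential if it has nonzero intersection with every nonzero ideal. -/
def LieIdeal.IsEssential (I : LieIdeal Φ L) : Prop := ∀ K : LieIdeal Φ L, K ≠ ⊥ → I ⊓ K ≠ ⊥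

theorem LieIdeal.isEssential_top : (⊤ : LieIdeal Φ L).IsEssential := by
  intro K hK; simpa using hK

theorem LieIdeal.IsEssential.inf {I W : LieIdeal Φ L} (hI : I.IsEssential) (hW : W.IsEssential) :
    (I ⊓ W).IsEssential := by
  intro K hK
  rw [inf_assoc]
  exact hI _ (hW K hK)

theorem IsSemiprimeLie.eq_zero_of_central [IsSemiprimeLie Φ L] {z : L}
    (hz : ∀ x : L, ⁅x, z⁆ = 0) : z = 0 := by
  have h : LieAlgebra.center Φ L = ⊥ := by
    apply IsSemiprimeLie.eq_bot
    intro x _ y hy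
    exact (LieModule.mem_maxTrivSubmodule Φ L L y).1 hy x
  have : z ∈ LieAlgebra.center Φ L := (LieModule.mem_maxTrivSubmodule Φ L L z).2 hz
  rw [h] at this
  simpa using this

variable (Φ L) in
/-- A permissible map `(f, I)` of a Lie algebra `L`: an additive map `f : I → L` on an essential
ideal `I` which commutes with all `ad x`, `x ∈ L` (equivalently, with all elements of the
subalgebra `Ad(L)` of `End(L)` which they generate). -/
structure LiePermissible where
  dom : LieIdeal Φ L
  essential : dom.IsEssential
  map : dom →+ L
  map_lie : ∀ (x : L) (y : dom), map ⟨⁅x, (y : L)⁆, dom.lie_mem y.2⟩ = ⁅x, map y⁆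

namespace LiePermissible

/-- Two permissible maps are equivalent if they agree on an essential ideal contained in both
domains. -/
def Rel (a b : LiePermissible Φ L) : Prop :=
  ∃ I : LieIdeal Φ L, I.IsEssential ∧
    ∀ x ∈ I, ∃ (ha : x ∈ a.dom) (hb : x ∈ b.dom), a.map ⟨x, ha⟩ = b.map ⟨x, hb⟩

theorem rel_of_agree {a b : LiePermissible Φ L}
    (h : ∀ x (ha : x ∈ a.dom) (hb : x ∈ b.dom), a.map ⟨x, ha⟩ = b.map ⟨x, hb⟩) : Rel a b :=
  ⟨a.dom ⊓ b.dom, a.essential.inf b.essential, fun x hx =>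
    ⟨((LieSubmodule.mem_inf _ _ _).1 hx).1, ((LieSubmodule.mem_inf _ _ _).1 hx).2, h x _ _⟩⟩

variable (Φ L) in
instance setoid : Setoid (LiePermissible Φ L) where
  r := Rel
  iseqv :=
    { refl := fun a => rel_of_agree (fun _ _ _ => rfl)
      symm := fun ⟨U, hU, hp⟩ => ⟨U, hU,
        fun x hx => by obtain ⟨h, h', e⟩ := hp x hx; exact ⟨h', h, e.symm⟩⟩
      trans := fun ⟨U, hU, hp⟩ ⟨W, hW, kp⟩ => ⟨U ⊓ W, hU.inf hW,
        fun x hx => by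
          obtain ⟨h, _, e⟩ := hp x ((LieSubmodule.mem_inf _ _ _).1 hx).1
          obtain ⟨_, k, e'⟩ := kp x ((LieSubmodule.mem_inf _ _ _).1 hx).2
          exact ⟨h, k, e.trans e'⟩⟩ }

theorem map_smul [IsSemiprimeLie Φ L] (a : LiePermissible Φ L) (c : Φ) (x : a.dom) :
    a.map (c • x) = c • a.map x := by
  rw [← sub_eq_zero]
  apply IsSemiprimeLie.eq_zero_of_central (Φ := Φ)
  intro y
  rw [lie_sub, lie_smul, ← smul_lie, ← a.map_lie, ← a.map_lie, sub_eq_zero]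
  congr 1
  ext
  simp

/-- The ideal `f⁻¹(W) = {x ∈ I | f(x) ∈ W}`. -/
def preimage [IsSemiprimeLie Φ L] (a : LiePermissible Φ L) (W : LieIdeal Φ L) : LieIdeal Φ L where
  carrier := {x | ∃ h : x ∈ a.dom, a.map ⟨x, h⟩ ∈ W}
  zero_mem' := ⟨a.dom.zero_mem, by
    rw [show (⟨0, a.dom.zero_mem⟩ : a.dom) = 0 from rfl, map_zero]; exact W.zero_mem⟩
  add_mem' := fun {x y} ⟨h, h'⟩ ⟨k, k'⟩ => ⟨a.dom.add_mem h k, by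
    rw [← AddMemClass.mk_add_mk _ _ _ h k, map_add]; exact W.add_mem h' k'⟩
  smul_mem' := fun c x ⟨h, h'⟩ => ⟨a.dom.smul_mem c h, by
    rw [← SetLike.mk_smul_mk _ c _ h, a.map_smul]; exact W.smul_mem c h'⟩
  lie_mem := fun {x y} ⟨h, h'⟩ => ⟨a.dom.lie_mem h, by
    rw [a.map_lie x ⟨y, h⟩]; exact W.lie_mem h'⟩

theorem preimage_isEssential [IsSemiprimeLie Φ L] (a : LiePermissible Φ L) {W : LieIdeal Φ L}
    (hW : W.IsEssential) : (a.preimage W).IsEssential := by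
  intro K hK h
  apply hW _ (a.essential K hK)
  apply IsSemiprimeLie.eq_bot
  intro x hx y hy
  simp only [LieSubmodule.mem_inf] at hx hy
  have : ⁅x, y⁆ ∈ a.preimage W ⊓ K := by
    refine (LieSubmodule.mem_inf _ _ _).2 ⟨⟨a.dom.lie_mem hy.2.1, ?_⟩, K.lie_mem hy.2.2⟩
    rw [a.map_lie x ⟨y, hy.2.1⟩]
    exact lie_mem_left Φ L W _ _ hx.1
  rw [h] at this
  simpa using this

instance : Zero (LiePermissible Φ L) where
  zero := ⟨⊤, LieIdeal.isEssential_top, 0, by simp⟩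

/-- The identity of `L`. -/
instance : One (LiePermissible Φ L) where
  one := ⟨⊤, LieIdeal.isEssential_top, ⟨⟨fun x => x, rfl⟩, fun _ _ => rfl⟩, fun _ _ => rfl⟩

instance : Neg (LiePermissible Φ L) where
  neg a := ⟨a.dom, a.essential, -a.map, fun x y => by simp [a.map_lie]⟩

/-- The sum `(f₁ + f₂, I₁ ∩ I₂)`. -/
instance : Add (LiePermissible Φ L) where
  add a b := ⟨a.dom ⊓ b.dom, a.essential.inf b.essential,
    { toFun := fun x => a.map ⟨x, ((LieSubmodule.mem_inf _ _ _).1 x.2).1⟩ +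
        b.map ⟨x, ((LieSubmodule.mem_inf _ _ _).1 x.2).2⟩
      map_zero' := (congrArg₂ (· + ·) (map_zero a.map) (map_zero b.map)).trans (add_zero _)
      map_add' := fun x y => by
        rw [add_add_add_comm, ← map_add, ← map_add]; rfl },
    fun x y => by
      rw [AddMonoidHom.coe_mk, ZeroHom.coe_mk, lie_add, ← a.map_lie, ← b.map_lie]⟩

/-- The product `(f₁ f₂, f₂⁻¹(I₁))`, given by composition. -/
instance [IsSemiprimeLie Φ L] : Mul (LiePermissible Φ L) where
  mul a b := ⟨b.preimage a.dom, b.preimage_isEssential a.essential,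
    { toFun := fun x => a.map ⟨b.map ⟨x, x.2.fst⟩, x.2.snd⟩
      map_zero' := (congrArg a.map (Subtype.ext (map_zero b.map))).trans (map_zero a.map)
      map_add' := fun x y => by
        rw [← map_add]; congr 1; ext
        exact map_add b.map ⟨x, x.2.fst⟩ ⟨y, y.2.fst⟩ },
    fun x y => (congrArg a.map (Subtype.ext (b.map_lie x ⟨y, y.2.fst⟩))).trans
      (a.map_lie x ⟨_, y.2.snd⟩)⟩

theorem rel_add {a a' b b' : LiePermissible Φ L} (h : Rel a a') (k : Rel b b') :
    Rel (a + b) (a' + b') := by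
  obtain ⟨U, hU, hp⟩ := h
  obtain ⟨W, hW, kp⟩ := k
  refine ⟨U ⊓ W, hU.inf hW, fun x hx => ?_⟩
  rw [LieSubmodule.mem_inf] at hx
  obtain ⟨h1, h2, e⟩ := hp x hx.1
  obtain ⟨k1, k2, e'⟩ := kp x hx.2
  exact ⟨(LieSubmodule.mem_inf _ _ _).2 ⟨h1, k1⟩, (LieSubmodule.mem_inf _ _ _).2 ⟨h2, k2⟩,
    congrArg₂ (· + ·) e e'⟩

theorem rel_neg {a a' : LiePermissible Φ L} (h : Rel a a') : Rel (-a) (-a') := by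
  obtain ⟨U, hU, hp⟩ := h
  refine ⟨U, hU, fun x hx => ?_⟩
  obtain ⟨h1, h2, e⟩ := hp x hx
  exact ⟨h1, h2, congrArg (-·) e⟩

theorem rel_mul [IsSemiprimeLie Φ L] {a a' b b' : LiePermissible Φ L} (h : Rel a a')
    (k : Rel b b') : Rel (a * b) (a' * b') := by
  obtain ⟨U, hU, hp⟩ := h
  obtain ⟨W, hW, kp⟩ := k
  refine ⟨b.preimage U ⊓ W, (b.preimage_isEssential hU).inf hW, fun x hx => ?_⟩
  rw [LieSubmodule.mem_inf] at hx
  obtain ⟨k1, k2, e'⟩ := kp x hx.2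
  obtain ⟨h1, h2, e⟩ := hp _ hx.1.snd
  exact ⟨⟨k1, h1⟩, ⟨k2, e' ▸ h2⟩, e.trans (congrArg a'.map (Subtype.ext e'))⟩

end LiePermissible

variable (Φ L) in
/-- The extended centroid `C(L)` of a Lie algebra `L`: classes of permissible maps. -/
def LieExtendedCentroid : Type _ := Quotient (LiePermissible.setoid Φ L)

namespace LieExtendedCentroid

open LiePermissible

/-- The class of a permissible map `(f, I)`. -/
def mk (a : LiePermissible Φ L) : LieExtendedCentroid Φ L := Quotient.mk _ a

instance : Zero (LieExtendedCentroid Φ L) := ⟨mk 0⟩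
instance : One (LieExtendedCentroid Φ L) := ⟨mk 1⟩
instance : Add (LieExtendedCentroid Φ L) := ⟨Quotient.map₂ (· + ·) (fun _ _ h _ _ k => rel_add h k)⟩
instance : Neg (LieExtendedCentroid Φ L) := ⟨Quotient.map (- ·) (fun _ _ h => rel_neg h)⟩
instance [IsSemiprimeLie Φ L] : Mul (LieExtendedCentroid Φ L) :=
  ⟨Quotient.map₂ (· * ·) (fun _ _ h _ _ k => rel_mul h k)⟩

/-- The ring structure of the extended centroid of a semiprime Lie algebra: addition of
representatives on the intersection of their domains, and composition of representatives on the
preimage of the domain. -/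
instance instRing [IsSemiprimeLie Φ L] : Ring (LieExtendedCentroid Φ L) where
  nsmul := nsmulRec
  zsmul := zsmulRec
  add_assoc := by
    rintro ⟨a⟩ ⟨b⟩ ⟨c⟩
    exact Quotient.sound (rel_of_agree (fun _ _ _ => add_assoc _ _ _))
  zero_add := by
    rintro ⟨a⟩
    exact Quotient.sound (rel_of_agree (fun _ _ _ => zero_add _))
  add_zero := by
    rintro ⟨a⟩
    exact Quotient.sound (rel_of_agree (fun _ _ _ => add_zero _))
  add_comm := by
    rintro ⟨a⟩ ⟨b⟩
    exact Quotient.sound (rel_of_agree (fun _ _ _ => add_comm _ _))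
  neg_add_cancel := by
    rintro ⟨a⟩
    exact Quotient.sound (rel_of_agree (fun _ _ _ => neg_add_cancel _))
  mul_assoc := by
    rintro ⟨a⟩ ⟨b⟩ ⟨c⟩
    exact Quotient.sound (rel_of_agree (fun _ _ _ => rfl))
  one_mul := by
    rintro ⟨a⟩
    exact Quotient.sound (rel_of_agree (fun _ _ _ => rfl))
  mul_one := by
    rintro ⟨a⟩
    exact Quotient.sound (rel_of_agree (fun _ _ _ => rfl))
  zero_mul := by
    rintro ⟨a⟩
    exact Quotient.sound (rel_of_agree (fun _ _ _ => rfl))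
  mul_zero := by
    rintro ⟨a⟩
    exact Quotient.sound (rel_of_agree (fun _ _ _ => map_zero a.map))
  left_distrib := by
    rintro ⟨a⟩ ⟨b⟩ ⟨c⟩
    exact Quotient.sound (rel_of_agree (fun _ _ h =>
      map_add a.map ⟨_, ((LieSubmodule.mem_inf _ _ _).1 h).1.snd⟩ ⟨_, ((LieSubmodule.mem_inf _ _ _).1 h).2.snd⟩))
  right_distrib := by
    rintro ⟨a⟩ ⟨b⟩ ⟨c⟩
    exact Quotient.sound (rel_of_agree (fun _ _ _ => rfl))

end LieExtendedCentroid

end LieCentroid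

/-! ### The Tits–Kantor–Koecher algebra of a Jordan pair -/

namespace JordanPair

variable {Φ Vp Vm : Type*} [CommRing Φ] [AddCommGroup Vp] [Module Φ Vp]
  [AddCommGroup Vm] [Module Φ Vm]

attribute [local instance 100] LieRing.ofAssociativeRing

section Identities

variable {Q : QuadraticMap Φ Vp (Vm →ₗ[Φ] Vp)} {Q' : QuadraticMap Φ Vm (Vp →ₗ[Φ] Vm)}

theorem quad_add (Q : QuadraticMap Φ Vp (Vm →ₗ[Φ] Vp)) (x z : Vp) (y : Vm) :
    Q (x + z) y = Q x y + Q z y + jordanTriple Q x y z := by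
  rw [jordanTriple_apply]; abel

/-- `D(x,y) D(x,v) = D(Q_x y, v) + Q_x Q_{y,v}` -/
theorem triple_triple (h : JordanPairIdentities Q Q') (x : Vp) (y v : Vm) (z : Vp) :
    jordanTriple Q x y (jordanTriple Q x v z) =
      jordanTriple Q (Q x y) v z + Q x (jordanTriple Q' y z v) := by
  have h1 := h.jp1_lin x z y v
  have h2 := h.jp2 x (y + v) z
  simp only [map_add, LinearMap.add_apply, quad_add, h.jp2 x y z, h.jp2 x v z] at h2
  rw [jordanTriple_comm Q z y] at h1
  have h3 : jordanTriple Q (Q x v) y z + jordanTriple Q (Q x y) v z =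
      jordanTriple Q x (jordanTriple Q' y x v) z := by
    apply add_left_cancel (a := jordanTriple Q x (Q' y x) z + jordanTriple Q x (Q' v x) z)
    rw [← h2]; abel
  rw [← h3] at h1
  apply add_left_cancel (a := jordanTriple Q (Q x v) y z)
  rw [h1]; abel

/-- `D(x,y) Q_u v = {{x,y,u},v,u} - Q_u {y,x,v}` -/
theorem triple_quad (h : JordanPairIdentities Q Q') (x u : Vp) (y v : Vm) :
    jordanTriple Q x y (Q u v) =
      jordanTriple Q (jordanTriple Q x y u) v u - Q u (jordanTriple Q' y x v) := by
  have := triple_triple h u v y x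
  rw [jordanTriple_comm Q u y x, jordanTriple_comm Q u v, jordanTriple_comm Q (Q u v),
    jordanTriple_comm Q' v x y] at this
  rw [this]; abel

theorem der_triple {a : Module.End Φ Vp} {a' : Module.End Φ Vm}
    (h : ∀ x y, a (Q x y) = jordanTriple Q (a x) y x + Q x (a' y)) (x : Vp) (y : Vm) (z : Vp) :
    a (jordanTriple Q x y z) = jordanTriple Q (a x) y z + jordanTriple Q x (a' y) z +
      jordanTriple Q x y (a z) := by
  rw [jordanTriple_apply Q x y z, map_sub, map_sub, h, h, h, jordanTriple_apply Q x (a' y) z,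
    jordanTriple_comm Q x y (a z)]
  simp only [map_add, LinearMap.add_apply]
  abel

theorem der_lie {a b : Module.End Φ Vp} {a' b' : Module.End Φ Vm}
    (ha : ∀ x y, a (Q x y) = jordanTriple Q (a x) y x + Q x (a' y))
    (hb : ∀ x y, b (Q x y) = jordanTriple Q (b x) y x + Q x (b' y)) (x : Vp) (y : Vm) :
    ⁅a, b⁆ (Q x y) = jordanTriple Q (⁅a, b⁆ x) y x + Q x (⁅a', b'⁆ y) := by
  simp only [LieRing.of_associative_ring_bracket, LinearMap.sub_apply, Module.End.mul_apply,
    map_sub]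
  rw [ha, hb, map_add, map_add, der_triple ha, der_triple hb, ha, hb,
    jordanTriple_comm Q (b x) y (a x)]
  abel

end Identities

/-- The Lie algebra `Der V` of derivations of `V`: pairs `(D⁺, D⁻)` of endomorphisms of `V⁺` and
`V⁻` such that `D(Q_x y) = {D(x), y, x} + Q_x D(y)`. -/
def Der (J : JordanPair Φ Vp Vm) :
    LieSubalgebra Φ (Module.End Φ Vp × Module.End Φ Vm) where
  carrier := {D | (∀ x y, D.1 (J.Qp x y) = J.Tp (D.1 x) y x + J.Qp x (D.2 y)) ∧
    (∀ y x, D.2 (J.Qm y x) = J.Tm (D.2 y) x y + J.Qm y (D.1 x))}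
  zero_mem' := by simp
  add_mem' := by
    rintro a b ⟨ha, ha'⟩ ⟨hb, hb'⟩
    constructor
    · intro x y; simp only [Prod.fst_add, Prod.snd_add, LinearMap.add_apply, map_add, ha, hb]; abel
    · intro x y; simp only [Prod.fst_add, Prod.snd_add, LinearMap.add_apply, map_add, ha', hb']; abel
  smul_mem' := by
    rintro c a ⟨ha, ha'⟩
    constructor
    · intro x y; simp [ha]
    · intro x y; simp [ha']
  lie_mem' := by
    rintro a b ⟨ha, ha'⟩ ⟨hb, hb'⟩
    exact ⟨der_lie ha hb, der_lie ha' hb'⟩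

/-- The inner derivation `δ(x, y) = (D_{x,y}, -D_{y,x})`. -/
def innerDer (J : JordanPair Φ Vp Vm) (x : Vp) (y : Vm) : J.Der :=
  ⟨(J.Tp x y, -J.Tm y x), by
    constructor
    · intro u v
      rw [triple_quad J.ids_pos, LinearMap.neg_apply, map_neg, sub_eq_add_neg]
    · intro v u
      rw [LinearMap.neg_apply, triple_quad J.ids_neg, LinearMap.neg_apply, map_neg,
        LinearMap.neg_apply, LinearMap.neg_apply]
      abel⟩

/-- `IDer V`: the ideal of `Der V` generated by the inner derivations. -/
def IDer (J : JordanPair Φ Vp Vm) : LieIdeal Φ J.Der :=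
  LieSubmodule.lieSpan Φ J.Der {D | ∃ x y, D = J.innerDer x y}

theorem innerDer_mem (J : JordanPair Φ Vp Vm) (x : Vp) (y : Vm) : J.innerDer x y ∈ J.IDer :=
  LieSubmodule.subset_lieSpan ⟨x, y, rfl⟩

/-- `IDer V` as a Lie algebra. -/
def InnDer (J : JordanPair Φ Vp Vm) : Type _ := J.IDer

instance (J : JordanPair Φ Vp Vm) : LieRing J.InnDer := inferInstanceAs (LieRing J.IDer)
instance (J : JordanPair Φ Vp Vm) : LieAlgebra Φ J.InnDer := inferInstanceAs (LieAlgebra Φ J.IDer)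

/-- The derivation underlying an element of `IDer V`. -/
def InnDer.toDer {J : JordanPair Φ Vp Vm} (D : J.InnDer) : J.Der := Subtype.val (p := (· ∈ J.IDer)) D

/-- `δ` as a bilinear map into `IDer V`. -/
def delta (J : JordanPair Φ Vp Vm) : Vp →ₗ[Φ] Vm →ₗ[Φ] J.InnDer :=
  LinearMap.mk₂ Φ (fun x y => (⟨J.innerDer x y, J.innerDer_mem x y⟩ : J.IDer))
    (fun x x' y => by
      apply Subtype.ext; apply Subtype.ext
      simp only [innerDer, map_add, LinearMap.add_apply, neg_add]; rfl)
    (fun c x y => by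
      apply Subtype.ext; apply Subtype.ext
      simp only [innerDer, map_smul, LinearMap.smul_apply, ← smul_neg]; rfl)
    (fun x y y' => by
      apply Subtype.ext; apply Subtype.ext
      simp only [innerDer, map_add, LinearMap.add_apply, neg_add]; rfl)
    (fun c x y => by
      apply Subtype.ext; apply Subtype.ext
      simp only [innerDer, map_smul, LinearMap.smul_apply, ← smul_neg]; rfl)

/-- The action of `IDer V` on `V⁺`. -/
def actp (J : JordanPair Φ Vp Vm) : J.InnDer →ₗ[Φ] Module.End Φ Vp where
  toFun D := D.toDer.1.1
  map_add' _ _ := rfl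
  map_smul' _ _ := rfl

/-- The action of `IDer V` on `V⁻`. -/
def actm (J : JordanPair Φ Vp Vm) : J.InnDer →ₗ[Φ] Module.End Φ Vm where
  toFun D := D.toDer.1.2
  map_add' _ _ := rfl
  map_smul' _ _ := rfl

theorem iDer_ext {J : JordanPair Φ Vp Vm} {D E : J.InnDer} (hp : ∀ x, J.actp D x = J.actp E x)
    (hm : ∀ y, J.actm D y = J.actm E y) : D = E :=
  Subtype.ext (Subtype.ext (Prod.ext (LinearMap.ext hp) (LinearMap.ext hm)))

@[simp] theorem actp_delta (J : JordanPair Φ Vp Vm) (x : Vp) (y : Vm) (z : Vp) :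
    J.actp (J.delta x y) z = J.Tp x y z := rfl

@[simp] theorem actm_delta (J : JordanPair Φ Vp Vm) (x : Vp) (y z : Vm) :
    J.actm (J.delta x y) z = -J.Tm y x z := rfl

@[simp] theorem actp_lie (J : JordanPair Φ Vp Vm) (D E : J.InnDer) (x : Vp) :
    J.actp ⁅D, E⁆ x = J.actp D (J.actp E x) - J.actp E (J.actp D x) := rfl

@[simp] theorem actm_lie (J : JordanPair Φ Vp Vm) (D E : J.InnDer) (x : Vm) :
    J.actm ⁅D, E⁆ x = J.actm D (J.actm E x) - J.actm E (J.actm D x) := rfl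

theorem lie_delta (J : JordanPair Φ Vp Vm) (D : J.InnDer) (x : Vp) (y : Vm) :
    ⁅D, J.delta x y⁆ = J.delta (J.actp D x) y + J.delta x (J.actm D y) := by
  apply iDer_ext
  · intro z
    simp only [actp_lie, map_add, LinearMap.add_apply, actp_delta]
    rw [sub_eq_iff_eq_add]
    exact der_triple D.toDer.2.1 x y z
  · intro z
    simp only [actm_lie, map_add, LinearMap.add_apply, actm_delta, map_neg]
    have : J.actm D (J.Tm y x z) = J.Tm (J.actm D y) x z + J.Tm y (J.actp D x) z +
      J.Tm y x (J.actm D z) := der_triple D.toDer.2.2 y x z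
    rw [this]; abel

/-- The underlying module of the Tits–Kantor–Koecher algebra,
`TKK(V) = V⁺ ⊕ IDer V ⊕ V⁻`. -/
def TKK (J : JordanPair Φ Vp Vm) : Type _ := Vp × J.InnDer × Vm

namespace TKK

variable {J : JordanPair Φ Vp Vm}

instance : AddCommGroup J.TKK := inferInstanceAs (AddCommGroup (Vp × J.InnDer × Vm))
instance : Module Φ J.TKK := inferInstanceAs (Module Φ (Vp × J.InnDer × Vm))

/-- The projection onto `TKK(V)₁ = V⁺`. -/
def pos : J.TKK →ₗ[Φ] Vp := LinearMap.fst Φ Vp (J.InnDer × Vm)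
/-- The projection onto `TKK(V)₀ = IDer V`. -/
def zer : J.TKK →ₗ[Φ] J.InnDer := LinearMap.fst Φ J.InnDer Vm ∘ₗ LinearMap.snd Φ Vp (J.InnDer × Vm)
/-- The projection onto `TKK(V)₋₁ = V⁻`. -/
def neg : J.TKK →ₗ[Φ] Vm := LinearMap.snd Φ J.InnDer Vm ∘ₗ LinearMap.snd Φ Vp (J.InnDer × Vm)

variable (J) in
/-- The inclusion of `V⁺`. -/
def inp : Vp →ₗ[Φ] J.TKK := LinearMap.inl Φ Vp (J.InnDer × Vm)
variable (J) in
/-- The inclusion of `V⁻`. -/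
def inm : Vm →ₗ[Φ] J.TKK := LinearMap.inr Φ Vp (J.InnDer × Vm) ∘ₗ LinearMap.inr Φ J.InnDer Vm

theorem ext {a b : J.TKK} (h : pos a = pos b) (h' : zer a = zer b) (h'' : neg a = neg b) :
    a = b := Prod.ext h (Prod.ext h' h'')

@[simp] theorem pos_inp (x : Vp) : pos (inp J x) = x := rfl
@[simp] theorem zer_inp (x : Vp) : zer (inp J x) = 0 := rfl
@[simp] theorem neg_inp (x : Vp) : neg (inp J x) = 0 := rfl
@[simp] theorem pos_inm (y : Vm) : pos (inm J y) = 0 := rfl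
@[simp] theorem zer_inm (y : Vm) : zer (inm J y) = 0 := rfl
@[simp] theorem neg_inm (y : Vm) : neg (inm J y) = y := rfl

/-- The Lie bracket of `TKK(V)`: for `x ∈ V⁺`, `y ∈ V⁻`, `D, E ∈ IDer V`,
`[x, y] = δ(x, y)`, `[D, x] = D⁺(x)`, `[D, y] = D⁻(y)`, `[D, E] = DE - ED`, and
`[V⁺, V⁺] = [V⁻, V⁻] = 0`. -/
instance : Bracket J.TKK J.TKK where
  bracket a b :=
    (J.actp (zer a) (pos b) - J.actp (zer b) (pos a),
      ⁅zer a, zer b⁆ + J.delta (pos a) (neg b) - J.delta (pos b) (neg a),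
      J.actm (zer a) (neg b) - J.actm (zer b) (neg a))

@[simp] theorem pos_lie (a b : J.TKK) :
    pos ⁅a, b⁆ = J.actp (zer a) (pos b) - J.actp (zer b) (pos a) := rfl
@[simp] theorem zer_lie (a b : J.TKK) :
    zer ⁅a, b⁆ = ⁅zer a, zer b⁆ + J.delta (pos a) (neg b) - J.delta (pos b) (neg a) := rfl
@[simp] theorem neg_lie (a b : J.TKK) :
    neg ⁅a, b⁆ = J.actm (zer a) (neg b) - J.actm (zer b) (neg a) := rfl

theorem jacobi_pos (a b c : J.TKK) : pos ⁅a, ⁅b, c⁆⁆ = pos (⁅⁅a, b⁆, c⁆ + ⁅b, ⁅a, c⁆⁆) := by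
  simp only [pos_lie, zer_lie, map_add, map_sub, LinearMap.add_apply,
    LinearMap.sub_apply, actp_lie, actp_delta]
  rw [jordanTriple_comm J.Qp (pos c) (neg a) (pos b),
    jordanTriple_comm J.Qp (pos c) (neg b) (pos a),
    jordanTriple_comm J.Qp (pos b) (neg c) (pos a)]
  abel

theorem jacobi_zer (a b c : J.TKK) : zer ⁅a, ⁅b, c⁆⁆ = zer (⁅⁅a, b⁆, c⁆ + ⁅b, ⁅a, c⁆⁆) := by
  have h1 : ∀ (x : Vp) (y : Vm) (D : J.InnDer),
      ⁅J.delta x y, D⁆ = -(J.delta (J.actp D x) y + J.delta x (J.actm D y)) := by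
    intro x y D
    rw [← lie_delta, lie_skew]
  have h2 := leibniz_lie (zer a) (zer b) (zer c)
  simp only [pos_lie, zer_lie, neg_lie, map_add, map_sub, LinearMap.sub_apply, lie_add, lie_sub,
    add_lie, sub_lie, lie_delta, h1]
  rw [h2]
  abel

theorem jacobi_neg (a b c : J.TKK) : neg ⁅a, ⁅b, c⁆⁆ = neg (⁅⁅a, b⁆, c⁆ + ⁅b, ⁅a, c⁆⁆) := by
  simp only [zer_lie, neg_lie, map_add, map_sub, LinearMap.add_apply,
    LinearMap.sub_apply, actm_lie, actm_delta]
  rw [jordanTriple_comm J.Qm (neg c) (pos a) (neg b),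
    jordanTriple_comm J.Qm (neg c) (pos b) (neg a),
    jordanTriple_comm J.Qm (neg b) (pos c) (neg a)]
  abel

instance : LieRing J.TKK where
  add_lie a b c := by
    apply ext <;> simp only [pos_lie, zer_lie, neg_lie, map_add, LinearMap.add_apply, add_lie] <;>
      abel
  lie_add a b c := by
    apply ext <;> simp only [pos_lie, zer_lie, neg_lie, map_add, LinearMap.add_apply, lie_add] <;>
      abel
  lie_self a := by
    apply ext <;> simp
  leibniz_lie a b c := ext (jacobi_pos a b c) (jacobi_zer a b c) (jacobi_neg a b c)

instance : LieAlgebra Φ J.TKK where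
  lie_smul c a b := by
    apply ext <;>
      simp only [pos_lie, zer_lie, neg_lie, map_smul, LinearMap.smul_apply, lie_smul, smul_sub,
        smul_add]

/-- If `Q_w a = 0` for all `w`, then `a = 0`. -/
theorem eq_zero_of_quad [Invertible (2 : Φ)] {Q : QuadraticMap Φ Vp (Vm →ₗ[Φ] Vp)}
    {Q' : QuadraticMap Φ Vm (Vp →ₗ[Φ] Vm)} (h : JordanPairIdentities Q Q')
    (h' : JordanPairIdentities Q' Q) (hQ : ∀ x : Vp, Q x = 0 → x = 0) (a : Vp)
    (ha : ∀ w, Q' w a = 0) : a = 0 := by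
  have h1 : ∀ w z, Q' w (Q a z) = 0 := by
    intro w z
    have := triple_triple h' w a a z
    rw [jordanTriple_self, ha, map_zero] at this
    simp only [jordanTriple_apply Q' _ a, ha, sub_self, map_zero, LinearMap.zero_apply, zero_add,
      map_smul] at this
    have h2 := congrArg (fun t => (⅟2 : Φ) • t) this
    simpa [smul_smul] using h2.symm
  apply hQ
  ext w
  apply hQ
  ext z
  rw [h.jp3, h1, map_zero, LinearMap.zero_apply]

/-- The Tits–Kantor–Koecher algebra of a nondegenerate Jordan pair is semiprime. -/
instance [Invertible (2 : Φ)] [J.IsNondegenerate] : IsSemiprimeLie Φ J.TKK where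
  eq_bot I hI := by
    have two : ∀ {M : Type _} [AddCommGroup M] [Module Φ M] (x : M), (2 : Φ) • x = 0 → x = 0 := by
      intro M _ _ x hx
      have h2 := congrArg (fun t => (⅟2 : Φ) • t) hx
      simpa [smul_smul] using h2
    have two' : ∀ {M : Type _} [AddCommGroup M] [Module Φ M] (x : M), (2 : Φ) • x = 0 → x = 0 := by
      intro M _ _ x hx
      have h2 := congrArg (fun t => (⅟2 : Φ) • t) hx
      simpa [smul_smul] using h2
    have hp : ∀ x, inp J x ∈ I → x = 0 := by
      intro x hx
      apply IsNondegenerate.pos (J := J)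
      ext v
      have h1 := hI _ (lie_mem_left Φ J.TKK I _ (inm J v) hx) _ hx
      have h2 := congrArg pos h1
      simp only [pos_lie, zer_lie, pos_inp, neg_inp, zer_inp, pos_inm, neg_inm, zer_inm, map_zero,
        LinearMap.zero_apply, sub_zero, lie_zero, zero_add, actp_delta, jordanTriple_self] at h2
      exact two _ h2
    have hm : ∀ y, inm J y ∈ I → y = 0 := by
      intro y hy
      apply IsNondegenerate.neg (J := J)
      ext v
      have h1 := hI _ (I.lie_mem (x := inp J v) hy) _ hy
      have h2 := congrArg neg h1
      simp only [neg_lie, zer_lie, pos_inp, neg_inp, zer_inp, pos_inm, neg_inm, zer_inm, map_zero,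
        LinearMap.zero_apply, sub_zero, lie_zero, zero_add, actm_delta, jordanTriple_self,
        neg_eq_zero] at h2
      exact two' _ h2
    rw [eq_bot_iff]
    intro a ha
    have hpa : pos a = 0 := by
      apply eq_zero_of_quad J.ids_pos J.ids_neg (IsNondegenerate.pos (J := J))
      intro w
      have h1 := I.lie_mem (x := inm J w) (I.lie_mem (x := inm J w) ha)
      have h2 : ⁅inm J w, ⁅inm J w, a⁆⁆ = inm J (-((2 : Φ) • J.Qm w (pos a))) := by
        apply ext <;> simp [jordanTriple_self]
      rw [h2] at h1
      exact two' _ (neg_eq_zero.1 (hm _ h1))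
    have hna : neg a = 0 := by
      apply eq_zero_of_quad J.ids_neg J.ids_pos (IsNondegenerate.neg (J := J))
      intro w
      have h1 := I.lie_mem (x := inp J w) (I.lie_mem (x := inp J w) ha)
      have h2 : ⁅inp J w, ⁅inp J w, a⁆⁆ = inp J (-((2 : Φ) • J.Qp w (neg a))) := by
        apply ext <;> simp [jordanTriple_self]
      rw [h2] at h1
      exact two _ (neg_eq_zero.1 (hp _ h1))
    have hza : zer a = 0 := by
      apply iDer_ext
      · intro x
        rw [map_zero, LinearMap.zero_apply]
        apply hp
        have h1 := lie_mem_left Φ J.TKK I _ (inp J x) ha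
        have h2 : ⁅a, inp J x⁆ = inp J (J.actp (zer a) x) := by
          apply ext <;> simp [hna]
        rwa [h2] at h1
      · intro y
        rw [map_zero, LinearMap.zero_apply]
        apply hm
        have h1 := lie_mem_left Φ J.TKK I _ (inm J y) ha
        have h2 : ⁅a, inm J y⁆ = inm J (J.actm (zer a) y) := by
          apply ext <;> simp [hpa]
        rwa [h2] at h1
    rw [LieSubmodule.mem_bot]
    exact ext hpa hza hna

/-- `(g, U)` is the restriction `(f|_{I ∩ V}, I ∩ V)` of `(f, I)`: `U^σ = I ∩ V^σ`, `f` maps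
`I ∩ V^σ` into `V^σ`, and `g^σ` is the map `I ∩ V^σ → V^σ` induced by `f`. -/
structure IsRestriction (p : LiePermissible Φ J.TKK) (q : J.Permissible) : Prop where
  mem_pos : ∀ x : Vp, x ∈ q.dom.pos ↔ inp J x ∈ p.dom
  mem_neg : ∀ y : Vm, y ∈ q.dom.neg ↔ inm J y ∈ p.dom
  map_pos : ∀ x : q.dom.pos, p.map ⟨inp J x, (mem_pos x).1 x.2⟩ = inp J (q.map.gp x)
  map_neg : ∀ y : q.dom.neg, p.map ⟨inm J y, (mem_neg y).1 y.2⟩ = inm J (q.map.gm y)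

end TKK

end JordanPair

/-! Write L = TKK(V). The link between the two structures is {x, y, z} = [[x, y], z]: a map
commuting with every ad x respects triple products, and 1/2 recovers Q_x y from {x, y, x} = 2 Q_x y.

Restriction preserves degree because V^σ is its own centralizer in L (`eq_inp_of_lie`,
`eq_inm_of_lie`). If y ∈ I ∩ V^σ and w ∈ V^σ, then [w, f(y)] = f([w, y]) = f(0) = 0, so f(y) ∈ V^σ
(`map_inp`, `map_inm`). No grading of I enters.

Essentiality passes both ways because every nonzero ideal of L meets V nontrivially
(`inter_ne_bot`). Thus I ∩ V is essential in V when I is essential in L (`inter_isEssential`), and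
an ideal of L containing an essential ideal of V is essential (`isEssential_of_le`). The latter
gives injectivity: if two restrictions agree on an essential U, the ideal of L on which the original
maps agree contains U.

For surjectivity, a permissible map g of V must be extended to L. The natural formula ∑ δ(uᵢ, yᵢ) ↦
∑ δ(g(uᵢ), yᵢ) in degree zero raises a question of well-definedness. It is avoided by working with
the relation `VHom.graph`, which pairs D with E when E = g ∘ D on V. This relation is single-valued,
since a derivation is determined by its action on V (`VHom.graph_unique`), and it is stable under
bracketing both entries with any x ∈ L (`VHom.graph_lie`). Hence it is the graph of a map that
commutes with ad L and is defined on an ideal containing U. -/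

namespace JordanPair

variable {Φ Vp Vm : Type*} [CommRing Φ] [AddCommGroup Vp] [Module Φ Vp]
  [AddCommGroup Vm] [Module Φ Vm] {J : JordanPair Φ Vp Vm}

/-! ### Inner derivations: spanning set and faithfulness on each half of V -/

theorem lie_innerDer (D : J.Der) (x : Vp) (y : Vm) :
    ⁅D, J.innerDer x y⁆ = J.innerDer (D.1.1 x) y + J.innerDer x (D.1.2 y) := by
  apply Subtype.ext
  apply Prod.ext
  · ext z
    change D.1.1 (J.Tp x y z) - J.Tp x y (D.1.1 z) = J.Tp (D.1.1 x) y z + J.Tp x (D.1.2 y) z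
    rw [sub_eq_iff_eq_add]
    exact der_triple D.2.1 x y z
  · ext z
    change D.1.2 (-J.Tm y x z) - -J.Tm y x (D.1.2 z) = -J.Tm y (D.1.1 x) z + -J.Tm (D.1.2 y) x z
    have : D.1.2 (J.Tm y x z) = J.Tm (D.1.2 y) x z + J.Tm y (D.1.1 x) z +
      J.Tm y x (D.1.2 z) := der_triple D.2.2 y x z
    rw [map_neg, this]; abel

variable (J) in
/-- The ideal of `Der V` formed by the linear combinations of inner derivations. -/
def innerSpan : LieIdeal Φ J.Der where
  __ := Submodule.span Φ {D : J.Der | ∃ x y, D = J.innerDer x y}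
  lie_mem {D E} hE := by
    change ⁅D, E⁆ ∈ Submodule.span Φ {D : J.Der | ∃ x y, D = J.innerDer x y}
    replace hE : E ∈ Submodule.span Φ {D : J.Der | ∃ x y, D = J.innerDer x y} := hE
    induction hE using Submodule.span_induction with
    | mem E h =>
      obtain ⟨x, y, rfl⟩ := h
      rw [lie_innerDer]
      exact Submodule.add_mem _ (Submodule.subset_span ⟨_, _, rfl⟩)
        (Submodule.subset_span ⟨_, _, rfl⟩)
    | zero => rw [lie_zero]; exact Submodule.zero_mem _
    | add a b _ _ ha hb => rw [lie_add]; exact Submodule.add_mem _ ha hb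
    | smul c a _ ha => rw [lie_smul]; exact Submodule.smul_mem _ c ha

/-- By [D, δ(x, y)] = δ(Dx, y) + δ(x, Dy), the linear span of the inner derivations is already an
ideal of Der V, so it is all of IDer V. A property stable under linear combinations therefore has to
be checked on the δ(x, y) only. -/
theorem innDer_induction {P : J.InnDer → Prop} (hδ : ∀ x y, P (J.delta x y)) (h0 : P 0)
    (hadd : ∀ D E, P D → P E → P (D + E)) (hsmul : ∀ (c : Φ) D, P D → P (c • D))
    (D : J.InnDer) : P D := by
  obtain ⟨D, hD⟩ := D
  have hle : J.IDer ≤ J.innerSpan :=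
    LieSubmodule.lieSpan_le.2 fun E hE => Submodule.subset_span hE
  have hspan : D ∈ Submodule.span Φ {D : J.Der | ∃ x y, D = J.innerDer x y} := hle hD
  -- Span induction runs in Der V, where P makes no sense, so membership in IDer V is carried along
  -- with P.
  suffices h : ∃ h' : D ∈ J.IDer, P ⟨D, h'⟩ from h.2
  clear hD
  induction hspan using Submodule.span_induction with
  | mem E h => obtain ⟨x, y, rfl⟩ := h; exact ⟨J.innerDer_mem x y, hδ x y⟩
  | zero => exact ⟨zero_mem _, h0⟩
  | add a b _ _ ha hb => exact ⟨add_mem ha.1 hb.1, hadd _ _ ha.2 hb.2⟩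
  | smul c a _ ha => exact ⟨J.IDer.smul_mem c ha.1, hsmul c _ ha.2⟩

theorem eq_zero_of_two_smul [Invertible (2 : Φ)] {M : Type*} [AddCommGroup M] [Module Φ M] {x : M}
    (hx : (2 : Φ) • x = 0) : x = 0 := by
  simpa [smul_smul] using congrArg (fun t => (⅟2 : Φ) • t) hx

theorem mem_of_two_smul_mem [Invertible (2 : Φ)] {M : Type*} [AddCommGroup M] [Module Φ M]
    {S : Submodule Φ M} {x : M} (hx : (2 : Φ) • x ∈ S) : x ∈ S := by
  simpa [smul_smul] using S.smul_mem (⅟2 : Φ) hx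

/-- A derivation which vanishes on `V⁺` is zero. -/
theorem innDer_eq_zero_of_actp [Invertible (2 : Φ)] [J.IsNondegenerate] {D : J.InnDer}
    (h : ∀ x, J.actp D x = 0) : D = 0 := by
  apply iDer_ext
  · simpa using h
  · intro y
    rw [map_zero, LinearMap.zero_apply]
    -- Once D vanishes on V⁺, the derivation rule for D(Q_w y) reduces to Q_w(Dy) = 0 for every w ∈
    -- V⁺.
    apply TKK.eq_zero_of_quad J.ids_neg J.ids_pos (IsNondegenerate.neg (J := J))
    intro w
    have : J.actp D (J.Qp w y) = J.Tp (J.actp D w) y w + J.Qp w (J.actm D y) := D.toDer.2.1 w y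
    simpa [h] using this.symm

/-- A derivation which vanishes on `V⁻` is zero. -/
theorem innDer_eq_zero_of_actm [Invertible (2 : Φ)] [J.IsNondegenerate] {D : J.InnDer}
    (h : ∀ y, J.actm D y = 0) : D = 0 := by
  apply iDer_ext
  · intro x
    rw [map_zero, LinearMap.zero_apply]
    apply TKK.eq_zero_of_quad J.ids_pos J.ids_neg (IsNondegenerate.pos (J := J))
    intro w
    have : J.actm D (J.Qm w x) = J.Tm (J.actm D w) x w + J.Qm w (J.actp D x) := D.toDer.2.2 w x
    simpa [h] using this.symm
  · simpa using h

/-! ### Ideals of V: stability under IDer V and in every slot of the triple product -/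

theorem Ideal.actp_mem (U : J.Ideal) (D : J.InnDer) : ∀ u ∈ U.pos, J.actp D u ∈ U.pos := by
  refine innDer_induction (P := fun D => ∀ u ∈ U.pos, J.actp D u ∈ U.pos) ?_ ?_ ?_ ?_ D
  · intro x y u hu; exact U.triple_pos x y u hu
  · simp
  · intro D E hD hE u hu
    rw [map_add]; exact add_mem (hD u hu) (hE u hu)
  · intro c D hD u hu
    rw [map_smul]; exact U.pos.smul_mem c (hD u hu)

theorem Ideal.actm_mem (U : J.Ideal) (D : J.InnDer) : ∀ u ∈ U.neg, J.actm D u ∈ U.neg := by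
  refine innDer_induction (P := fun D => ∀ u ∈ U.neg, J.actm D u ∈ U.neg) ?_ ?_ ?_ ?_ D
  · intro x y u hu; exact neg_mem (U.triple_neg y x u hu)
  · simp
  · intro D E hD hE u hu
    rw [map_add]; exact add_mem (hD u hu) (hE u hu)
  · intro c D hD u hu
    rw [map_smul]; exact U.neg.smul_mem c (hD u hu)

theorem Ideal.triple_mid_pos (U : J.Ideal) (x z : Vp) {u : Vm} (hu : u ∈ U.neg) :
    J.Tp x u z ∈ U.pos := by
  rw [jordanTriple_apply]
  exact sub_mem (sub_mem (U.outer_pos _ _ hu) (U.outer_pos _ _ hu)) (U.outer_pos _ _ hu)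

theorem Ideal.triple_mid_neg (U : J.Ideal) (x z : Vm) {u : Vp} (hu : u ∈ U.pos) :
    J.Tm x u z ∈ U.neg := by
  rw [jordanTriple_apply]
  exact sub_mem (sub_mem (U.outer_neg _ _ hu) (U.outer_neg _ _ hu)) (U.outer_neg _ _ hu)

theorem Ideal.triple_right_pos (U : J.Ideal) (x : Vp) (y : Vm) {u : Vp} (hu : u ∈ U.pos) :
    J.Tp u y x ∈ U.pos := by
  rw [jordanTriple_comm]; exact U.triple_pos x y u hu

theorem Ideal.triple_right_neg (U : J.Ideal) (x : Vm) (y : Vp) {u : Vm} (hu : u ∈ U.neg) :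
    J.Tm u y x ∈ U.neg := by
  rw [jordanTriple_comm]; exact U.triple_neg x y u hu

theorem Ideal.ne_bot_iff {U : J.Ideal} :
    U ≠ ⊥ ↔ (∃ x ∈ U.pos, x ≠ 0) ∨ ∃ y ∈ U.neg, y ≠ 0 := by
  rw [← not_iff_not, not_not, not_or]
  push Not
  constructor
  · rintro rfl; simp
  · rintro ⟨h, h'⟩
    exact Ideal.ext ((Submodule.eq_bot_iff _).2 h) ((Submodule.eq_bot_iff _).2 h')

namespace TKK

/-! ### Passage between ideals of V and ideals of TKK(V) -/

section Ideals

/-- The ideal of `TKK(V)` of all `u + D + v` with `u ∈ U⁺`, `v ∈ U⁻`, `D(V) ⊆ U`. -/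
def ofIdeal (U : J.Ideal) : LieIdeal Φ J.TKK where
  -- The degree-zero part takes every D with D(V) ⊆ U, not just the combinations of δ(U⁺, V⁻) and
  -- δ(V⁺, U⁻). This makes stability under brackets direct, and only the intersection with V matters
  -- later.
  carrier := {a | pos a ∈ U.pos ∧ neg a ∈ U.neg ∧ (∀ x, J.actp (zer a) x ∈ U.pos) ∧
    ∀ y, J.actm (zer a) y ∈ U.neg}
  zero_mem' := by simp
  add_mem' := by
    rintro a b ⟨h1, h2, h3, h4⟩ ⟨k1, k2, k3, k4⟩
    simp only [Set.mem_ofPred_eq, map_add, LinearMap.add_apply]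
    exact ⟨add_mem h1 k1, add_mem h2 k2, fun x => add_mem (h3 x) (k3 x),
      fun x => add_mem (h4 x) (k4 x)⟩
  smul_mem' := by
    rintro c a ⟨h1, h2, h3, h4⟩
    simp only [Set.mem_ofPred_eq, map_smul, LinearMap.smul_apply]
    exact ⟨U.pos.smul_mem c h1, U.neg.smul_mem c h2, fun x => U.pos.smul_mem c (h3 x),
      fun x => U.neg.smul_mem c (h4 x)⟩
  lie_mem := by
    rintro x a ⟨h1, h2, h3, h4⟩
    refine ⟨?_, ?_, fun z => ?_, fun z => ?_⟩
    · rw [pos_lie]; exact sub_mem (U.actp_mem _ _ h1) (h3 _)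
    · rw [neg_lie]; exact sub_mem (U.actm_mem _ _ h2) (h4 _)
    · simp only [zer_lie, map_add, map_sub, LinearMap.add_apply, LinearMap.sub_apply, actp_lie,
        actp_delta]
      exact sub_mem (add_mem (sub_mem (U.actp_mem _ _ (h3 z)) (h3 _)) (U.triple_mid_pos _ _ h2))
        (U.triple_right_pos _ _ h1)
    · simp only [zer_lie, map_add, map_sub, LinearMap.add_apply, LinearMap.sub_apply, actm_lie,
        actm_delta]
      exact sub_mem (add_mem (sub_mem (U.actm_mem _ _ (h4 z)) (h4 _))
        (neg_mem (U.triple_right_neg _ _ h2))) (neg_mem (U.triple_mid_neg _ _ h1))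

theorem inp_mem_ofIdeal {U : J.Ideal} {x : Vp} : inp J x ∈ ofIdeal U ↔ x ∈ U.pos := by
  refine ⟨fun h => h.1, fun h => ⟨h, ?_⟩⟩
  simp

theorem inm_mem_ofIdeal {U : J.Ideal} {y : Vm} : inm J y ∈ ofIdeal U ↔ y ∈ U.neg := by
  refine ⟨fun h => h.2.1, fun h => ⟨?_, h, ?_⟩⟩ <;> simp

/-- Two bracket forms of the triple product are kept. This one serves an ideal element in the middle
or last slot; in `triple_inp'` the first slot is innermost on the right, so an ideal element there
is reached by two applications of ad. -/
theorem triple_inp (x z : Vp) (y : Vm) : inp J (J.Tp x y z) = ⁅⁅inp J x, inm J y⁆, inp J z⁆ := by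
  apply ext <;> simp [jordanTriple_comm _ x y z]

theorem triple_inm (x z : Vm) (y : Vp) : inm J (J.Tm x y z) = ⁅⁅inm J x, inp J y⁆, inm J z⁆ := by
  apply ext <;> simp [jordanTriple_comm _ x y z]

theorem triple_inp' (x z : Vp) (y : Vm) : inp J (J.Tp x y z) = ⁅inp J z, ⁅inm J y, inp J x⁆⁆ := by
  apply ext <;> simp

theorem triple_inm' (x z : Vm) (y : Vp) : inm J (J.Tm x y z) = ⁅inm J z, ⁅inp J y, inm J x⁆⁆ := by
  apply ext <;> simp

variable [Invertible (2 : Φ)]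

/-- The ideal `I ∩ V = (I ∩ V⁺, I ∩ V⁻)` of `V`. -/
def inter (I : LieIdeal Φ J.TKK) : J.Ideal where
  pos := (I : Submodule Φ J.TKK).comap (inp J)
  neg := (I : Submodule Φ J.TKK).comap (inm J)
  -- Brackets only see 2 Q_u y = {u, y, u}; the factor is removed with 1/2, here and in the next
  -- three fields.
  inner_pos u hu y := mem_of_two_smul_mem <| by
    rw [← jordanTriple_self, Submodule.mem_comap, triple_inp']
    exact I.lie_mem (I.lie_mem hu)
  inner_neg u hu x := mem_of_two_smul_mem <| by
    rw [← jordanTriple_self, Submodule.mem_comap, triple_inm']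
    exact I.lie_mem (I.lie_mem hu)
  outer_pos x u hu := mem_of_two_smul_mem <| by
    rw [← jordanTriple_self, Submodule.mem_comap, triple_inp]
    exact lie_mem_left Φ J.TKK I _ _ (I.lie_mem hu)
  outer_neg y u hu := mem_of_two_smul_mem <| by
    rw [← jordanTriple_self, Submodule.mem_comap, triple_inm]
    exact lie_mem_left Φ J.TKK I _ _ (I.lie_mem hu)
  triple_pos x y u hu := by
    rw [Submodule.mem_comap, triple_inp]
    exact I.lie_mem hu
  triple_neg y x u hu := by
    rw [Submodule.mem_comap, triple_inm]
    exact I.lie_mem hu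

theorem mem_inter_pos {I : LieIdeal Φ J.TKK} {x : Vp} : x ∈ (inter I).pos ↔ inp J x ∈ I := Iff.rfl

theorem mem_inter_neg {I : LieIdeal Φ J.TKK} {y : Vm} : y ∈ (inter I).neg ↔ inm J y ∈ I := Iff.rfl

variable [J.IsNondegenerate]

/-- A nonzero ideal of `TKK(V)` meets `V` nontrivially. -/
theorem inter_ne_bot {I : LieIdeal Φ J.TKK} (hI : I ≠ ⊥) : inter I ≠ ⊥ := by
  contrapose! hI
  have hp : ∀ x, inp J x ∈ I → x = 0 := by
    intro x hx
    rw [← mem_inter_pos, hI] at hx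
    simpa using hx
  have hm : ∀ y, inm J y ∈ I → y = 0 := by
    intro y hy
    rw [← mem_inter_neg, hI] at hy
    simpa using hy
  rw [eq_bot_iff]
  intro a ha
  -- For w ∈ V⁻, (ad w)² lowers the degree by two, so it kills all of a but its V⁺-part and gives -2
  -- Q_w(a⁺) ∈ I ∩ V⁻ = 0.
  have hpa : pos a = 0 := by
    apply eq_zero_of_quad J.ids_pos J.ids_neg (IsNondegenerate.pos (J := J))
    intro w
    have h1 := I.lie_mem (x := inm J w) (I.lie_mem (x := inm J w) ha)
    have h2 : ⁅inm J w, ⁅inm J w, a⁆⁆ = inm J (-((2 : Φ) • J.Qm w (pos a))) := by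
      apply ext <;> simp [jordanTriple_self]
    rw [h2] at h1
    exact eq_zero_of_two_smul (neg_eq_zero.1 (hm _ h1))
  have hna : neg a = 0 := by
    apply eq_zero_of_quad J.ids_neg J.ids_pos (IsNondegenerate.neg (J := J))
    intro w
    have h1 := I.lie_mem (x := inp J w) (I.lie_mem (x := inp J w) ha)
    have h2 : ⁅inp J w, ⁅inp J w, a⁆⁆ = inp J (-((2 : Φ) • J.Qp w (neg a))) := by
      apply ext <;> simp [jordanTriple_self]
    rw [h2] at h1
    exact eq_zero_of_two_smul (neg_eq_zero.1 (hp _ h1))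
  -- With a⁻ = 0, the bracket [a, x] for x ∈ V⁺ is the pure element D(x) of I ∩ V⁺, where D is the
  -- degree-zero part of a.
  have hza : zer a = 0 := by
    apply innDer_eq_zero_of_actp
    intro x
    apply hp
    have h1 := lie_mem_left Φ J.TKK I _ (inp J x) ha
    have h2 : ⁅a, inp J x⁆ = inp J (J.actp (zer a) x) := by
      apply ext <;> simp [hna]
    rwa [h2] at h1
  rw [LieSubmodule.mem_bot]
  exact ext hpa hza hna

/-- A nonzero ideal K of V gives the nonzero ideal `ofIdeal K` of TKK(V). Its intersection with I is
nonzero, hence meets V nontrivially, and it does so inside (I ∩ V) ∩ K. -/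
theorem inter_isEssential {I : LieIdeal Φ J.TKK} (hI : I.IsEssential) :
    (inter I).IsEssential := by
  intro K hK
  have hne : ofIdeal K ≠ ⊥ := by
    rintro h
    rcases Ideal.ne_bot_iff.1 hK with ⟨x, hx, h0⟩ | ⟨y, hy, h0⟩
    · have := inp_mem_ofIdeal.2 hx
      rw [h, LieSubmodule.mem_bot] at this
      exact h0 (congrArg pos this)
    · have := inm_mem_ofIdeal.2 hy
      rw [h, LieSubmodule.mem_bot] at this
      exact h0 (congrArg neg this)
  have := inter_ne_bot (hI _ hne)
  rw [Ideal.ne_bot_iff] at this ⊢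
  rcases this with ⟨x, hx, h0⟩ | ⟨y, hy, h0⟩
  · rw [mem_inter_pos, LieSubmodule.mem_inf] at hx
    exact Or.inl ⟨x, ⟨hx.1, inp_mem_ofIdeal.1 hx.2⟩, h0⟩
  · rw [mem_inter_neg, LieSubmodule.mem_inf] at hy
    exact Or.inr ⟨y, ⟨hy.1, inm_mem_ofIdeal.1 hy.2⟩, h0⟩

/-- A nonzero ideal K of TKK(V) has K ∩ V ≠ 0, so U already meets K ∩ V, and that intersection lies
in I ∩ K. -/
theorem isEssential_of_le {I : LieIdeal Φ J.TKK} {U : J.Ideal} (hU : U.IsEssential)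
    (hp : ∀ x ∈ U.pos, inp J x ∈ I) (hm : ∀ y ∈ U.neg, inm J y ∈ I) : I.IsEssential := by
  intro K hK h
  rcases Ideal.ne_bot_iff.1 (hU _ (inter_ne_bot hK)) with ⟨x, hx, h0⟩ | ⟨y, hy, h0⟩
  · have : inp J x ∈ I ⊓ K := (LieSubmodule.mem_inf _ _ _).2 ⟨hp x hx.1, hx.2⟩
    rw [h, LieSubmodule.mem_bot] at this
    exact h0 (congrArg pos this)
  · have : inm J y ∈ I ⊓ K := (LieSubmodule.mem_inf _ _ _).2 ⟨hm y hy.1, hy.2⟩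
    rw [h, LieSubmodule.mem_bot] at this
    exact h0 (congrArg neg this)

end Ideals

/-! ### Restriction of permissible maps from TKK(V) to V -/

section Restriction

theorem lie_inp_inp (x z : Vp) : ⁅inp J x, inp J z⁆ = 0 := by
  apply ext <;> simp

theorem lie_inm_inm (x z : Vm) : ⁅inm J x, inm J z⁆ = 0 := by
  apply ext <;> simp

/-- Any membership proof for the bracket is accepted, so the lemma rewrites whatever proof the
argument happens to carry. -/
theorem map_lie_of_eq (p : LiePermissible Φ J.TKK) {a b : J.TKK} {x : J.TKK} (ha : a ∈ p.dom) (hb : b ∈ p.dom)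
    (h : b = ⁅x, a⁆) : p.map ⟨b, hb⟩ = ⁅x, p.map ⟨a, ha⟩⁆ := by
  subst h; exact p.map_lie x ⟨a, ha⟩

theorem map_lie_left (p : LiePermissible Φ J.TKK) {a x : J.TKK} (ha : a ∈ p.dom) (hb : ⁅a, x⁆ ∈ p.dom) :
    p.map ⟨⁅a, x⁆, hb⟩ = ⁅p.map ⟨a, ha⟩, x⁆ := by
  have h1 : (⟨⁅a, x⁆, hb⟩ : p.dom) = -⟨⁅x, a⁆, p.dom.lie_mem ha⟩ := Subtype.ext (by simp)
  rw [h1, map_neg, map_lie_of_eq p ha _ rfl, lie_skew]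

variable [Invertible (2 : Φ)] [J.IsNondegenerate]

/-- V⁺ contains its centralizer. The V⁺-part of [w, c] is -D(w), with D the degree-zero part of c,
so D vanishes on V⁺ and hence D = 0. The degree-zero part is then δ(w, c⁻) = 0; applied to c⁻ itself
it gives 2 Q_{c⁻} w = 0 for all w, and nondegeneracy yields c⁻ = 0. -/
theorem eq_inp_of_lie {c : J.TKK} (h : ∀ w, ⁅inp J w, c⁆ = 0) : c = inp J (pos c) := by
  have hz : zer c = 0 := innDer_eq_zero_of_actp fun w => by
    simpa using congrArg pos (h w)
  have hn : neg c = 0 := by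
    apply IsNondegenerate.neg (J := J)
    ext w
    have := congrArg (fun t => J.actm (zer t) (neg c)) (h w)
    simp only [zer_lie, zer_inp, zero_lie, pos_inp, neg_inp, map_zero, sub_zero, zero_add,
      actm_delta, jordanTriple_self, LinearMap.zero_apply, neg_eq_zero] at this
    exact eq_zero_of_two_smul this
  apply ext <;> simp [hz, hn]

theorem eq_inm_of_lie {c : J.TKK} (h : ∀ w, ⁅inm J w, c⁆ = 0) : c = inm J (neg c) := by
  have hz : zer c = 0 := innDer_eq_zero_of_actm fun w => by
    simpa using congrArg neg (h w)
  have hn : pos c = 0 := by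
    apply IsNondegenerate.pos (J := J)
    ext w
    have := congrArg (fun t => J.actp (zer t) (pos c)) (h w)
    simp only [zer_lie, zer_inm, zero_lie, pos_inm, neg_inm, map_zero, zero_sub,
      add_zero, actp_delta, jordanTriple_self, LinearMap.zero_apply, neg_eq_zero, map_neg,
      LinearMap.neg_apply] at this
    exact eq_zero_of_two_smul this
  apply ext <;> simp [hz, hn]

variable (p : LiePermissible Φ J.TKK)

/-- V⁺ is abelian, so [w, f(x)] = f([w, x]) = 0 for all w ∈ V⁺, and f(x) lies in the centralizer of
V⁺. -/
theorem map_inp {x : Vp} (hx : inp J x ∈ p.dom) :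
    p.map ⟨inp J x, hx⟩ = inp J (pos (p.map ⟨inp J x, hx⟩)) := by
  apply eq_inp_of_lie
  intro w
  rw [← map_lie_of_eq p hx (p.dom.lie_mem hx) rfl, ← map_zero p.map]
  congr 1
  exact Subtype.ext (lie_inp_inp w x)

theorem map_inm {y : Vm} (hy : inm J y ∈ p.dom) :
    p.map ⟨inm J y, hy⟩ = inm J (neg (p.map ⟨inm J y, hy⟩)) := by
  apply eq_inm_of_lie
  intro w
  rw [← map_lie_of_eq p hy (p.dom.lie_mem hy) rfl, ← map_zero p.map]
  congr 1
  exact Subtype.ext (lie_inm_inm w y)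

/-- The map `I ∩ V⁺ → V⁺` induced by a permissible map `(f, I)` of `TKK(V)`. -/
def restrictPos : (inter p.dom).pos →ₗ[Φ] Vp where
  toFun x := pos (p.map ⟨inp J x, x.2⟩)
  map_add' x y := by
    rw [← map_add, ← map_add]
    exact congrArg (fun t => pos (p.map t)) (Subtype.ext (map_add (inp J) _ _))
  -- f is only assumed additive; its Φ-linearity comes from `LiePermissible.map_smul`, that is, from
  -- semiprimeness of TKK(V).
  map_smul' c x := by
    rw [RingHom.id_apply, ← map_smul, ← p.map_smul]
    exact congrArg (fun t => pos (p.map t)) (Subtype.ext (map_smul (inp J) _ _))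

/-- The map `I ∩ V⁻ → V⁻` induced by a permissible map `(f, I)` of `TKK(V)`. -/
def restrictNeg : (inter p.dom).neg →ₗ[Φ] Vm where
  toFun y := neg (p.map ⟨inm J y, y.2⟩)
  map_add' x y := by
    rw [← map_add, ← map_add]
    exact congrArg (fun t => neg (p.map t)) (Subtype.ext (map_add (inm J) _ _))
  map_smul' c x := by
    rw [RingHom.id_apply, ← map_smul, ← p.map_smul]
    exact congrArg (fun t => neg (p.map t)) (Subtype.ext (map_smul (inm J) _ _))

theorem map_eq_restrictPos (x : (inter p.dom).pos) :
    p.map ⟨inp J x, x.2⟩ = inp J (restrictPos p x) := map_inp p x.2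

theorem map_eq_restrictNeg (y : (inter p.dom).neg) :
    p.map ⟨inm J y, y.2⟩ = inm J (restrictNeg p y) := map_inm p y.2

/-- f commutes with left and right brackets, hence passes through [[x, y], z] to the middle entry.
The case z = x, halved, is the rule for Q_x y. -/
theorem restrictPos_mid (x z : Vp) (y : (inter p.dom).neg) :
    restrictPos p ⟨J.Tp x y z, (inter p.dom).triple_mid_pos x z y.2⟩ =
      J.Tp x (restrictNeg p y) z := by
  -- Quantifying over the membership proof lets its type be rewritten together with the argument.
  have h : ∀ h', p.map ⟨inp J (J.Tp x y z), h'⟩ = inp J (J.Tp x (restrictNeg p y) z) := by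
    rw [triple_inp, triple_inp, ← map_eq_restrictNeg]
    intro h'
    rw [map_lie_left p (p.dom.lie_mem y.2), map_lie_of_eq p y.2 _ rfl]
  exact congrArg pos (h _)

theorem restrictNeg_mid (x z : Vm) (y : (inter p.dom).pos) :
    restrictNeg p ⟨J.Tm x y z, (inter p.dom).triple_mid_neg x z y.2⟩ =
      J.Tm x (restrictPos p y) z := by
  have h : ∀ h', p.map ⟨inm J (J.Tm x y z), h'⟩ = inm J (J.Tm x (restrictPos p y) z) := by
    rw [triple_inm, triple_inm, ← map_eq_restrictPos]
    intro h'
    rw [map_lie_left p (p.dom.lie_mem y.2), map_lie_of_eq p y.2 _ rfl]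
  exact congrArg neg (h _)

/-- The `V`-homomorphism `f_{I ∩ V}` on `I ∩ V`. -/
def restrictHom : J.VHom (inter p.dom) :=
  VHom.mk' J (inter p.dom) (restrictPos p) (restrictNeg p)
    (fun x y => by
      -- The middle-slot identity with equal outer entries is twice the required one.
      have h := (restrictPos_mid p x x y).trans (jordanTriple_self _ _ _)
      rw [← sub_eq_zero]
      apply eq_zero_of_two_smul (Φ := Φ)
      rw [smul_sub, ← h, ← map_smul, sub_eq_zero]
      congr 1
      exact Subtype.ext (jordanTriple_self _ _ _).symm)
    (fun x y => by
      have h := (restrictNeg_mid p x x y).trans (jordanTriple_self _ _ _)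
      rw [← sub_eq_zero]
      apply eq_zero_of_two_smul (Φ := Φ)
      rw [smul_sub, ← h, ← map_smul, sub_eq_zero]
      congr 1
      exact Subtype.ext (jordanTriple_self _ _ _).symm)
    (fun y z x => by
      have h : ∀ h', p.map ⟨inp J (J.Tp y z x), h'⟩ = inp J (J.Tp (restrictPos p y) z x) := by
        rw [triple_inp', triple_inp', ← map_eq_restrictPos]
        intro h'
        rw [map_lie_of_eq p (p.dom.lie_mem y.2) _ rfl, map_lie_of_eq p y.2 _ rfl]
      exact congrArg pos (h _))
    (fun y z x => by
      have h : ∀ h', p.map ⟨inm J (J.Tm y z x), h'⟩ = inm J (J.Tm (restrictNeg p y) z x) := by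
        rw [triple_inm', triple_inm', ← map_eq_restrictNeg]
        intro h'
        rw [map_lie_of_eq p (p.dom.lie_mem y.2) _ rfl, map_lie_of_eq p y.2 _ rfl]
      exact congrArg neg (h _))

/-- The restriction `(f_{I ∩ V}, I ∩ V)` of a permissible map `(f, I)` of `TKK(V)`. -/
def restrict : J.Permissible :=
  ⟨inter p.dom, inter_isEssential p.essential, restrictHom p⟩

theorem isRestriction_restrict : IsRestriction p (restrict p) where
  mem_pos _ := Iff.rfl
  mem_neg _ := Iff.rfl
  map_pos := map_eq_restrictPos p
  map_neg := map_eq_restrictNeg p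

/-! ### The induced injective ring homomorphism on classes -/

theorem restrict_rel {p q : LiePermissible Φ J.TKK} (h : LiePermissible.Rel p q) :
    Permissible.Rel (restrict p) (restrict q) := by
  obtain ⟨I, hI, h⟩ := h
  refine ⟨inter I, inter_isEssential hI, fun x hx => ?_, fun y hy => ?_⟩
  · obtain ⟨ha, hb, e⟩ := h _ hx
    exact ⟨ha, hb, congrArg pos e⟩
  · obtain ⟨ha, hb, e⟩ := h _ hy
    exact ⟨ha, hb, congrArg neg e⟩

/-- The ideal on which two permissible maps agree. -/
def equalizer (p q : LiePermissible Φ J.TKK) : LieIdeal Φ J.TKK where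
  carrier := {a | ∃ (ha : a ∈ p.dom) (hb : a ∈ q.dom), p.map ⟨a, ha⟩ = q.map ⟨a, hb⟩}
  zero_mem' := ⟨zero_mem _, zero_mem _, (map_zero p.map).trans (map_zero q.map).symm⟩
  add_mem' := by
    rintro a b ⟨h1, h2, e⟩ ⟨k1, k2, e'⟩
    exact ⟨add_mem h1 k1, add_mem h2 k2, (map_add p.map ⟨a, h1⟩ ⟨b, k1⟩).trans
      ((congrArg₂ (· + ·) e e').trans (map_add q.map ⟨a, h2⟩ ⟨b, k2⟩).symm)⟩
  smul_mem' := by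
    rintro c a ⟨h1, h2, e⟩
    exact ⟨p.dom.smul_mem c h1, q.dom.smul_mem c h2, (p.map_smul c ⟨a, h1⟩).trans
      ((congrArg (c • ·) e).trans (q.map_smul c ⟨a, h2⟩).symm)⟩
  lie_mem := by
    rintro x a ⟨h1, h2, e⟩
    exact ⟨p.dom.lie_mem h1, q.dom.lie_mem h2, (p.map_lie x ⟨a, h1⟩).trans
      ((congrArg (⁅x, ·⁆) e).trans (q.map_lie x ⟨a, h2⟩).symm)⟩

theorem rel_of_restrict_rel {p q : LiePermissible Φ J.TKK}
    (h : Permissible.Rel (restrict p) (restrict q)) : LiePermissible.Rel p q := by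
  obtain ⟨U, hU, hp, hm⟩ := h
  -- The equalizer is an ideal of TKK(V) containing the essential ideal U of V on which the
  -- restrictions agree.
  refine ⟨equalizer p q, isEssential_of_le hU (fun x hx => ?_) (fun y hy => ?_), fun _ hx => hx⟩
  · obtain ⟨ha, hb, e⟩ := hp x hx
    exact ⟨ha, hb, (map_eq_restrictPos p ⟨x, ha⟩).trans
      ((congrArg (inp J) e).trans (map_eq_restrictPos q ⟨x, hb⟩).symm)⟩
  · obtain ⟨ha, hb, e⟩ := hm y hy
    exact ⟨ha, hb, (map_eq_restrictNeg p ⟨y, ha⟩).trans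
      ((congrArg (inm J) e).trans (map_eq_restrictNeg q ⟨y, hb⟩).symm)⟩

/-- Restriction of permissible maps, on classes. -/
def restrictClass : LieExtendedCentroid Φ J.TKK → J.ExtendedCentroid :=
  Quotient.map restrict (fun _ _ h => restrict_rel h)

theorem restrictClass_add (a b : LieExtendedCentroid Φ J.TKK) :
    restrictClass (a + b) = restrictClass a + restrictClass b := by
  obtain ⟨p⟩ := a
  obtain ⟨q⟩ := b
  exact Quotient.sound (Permissible.rel_of_agree (fun _ _ _ => map_add pos _ _)
    (fun _ _ _ => map_add neg _ _))

/-- Projecting the inner value to V^σ before applying the outer map loses nothing, because that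
value already lies in V^σ. The comparison is made on the intersection of the two domains, so these
need not be identified. -/
theorem restrictClass_mul (a b : LieExtendedCentroid Φ J.TKK) :
    restrictClass (a * b) = restrictClass a * restrictClass b := by
  obtain ⟨p⟩ := a
  obtain ⟨q⟩ := b
  refine Quotient.sound (Permissible.rel_of_agree (fun x _ hb => ?_) (fun x _ hb => ?_))
  · exact congrArg (fun t => pos (p.map t)) (Subtype.ext (map_eq_restrictPos q ⟨x, hb.fst⟩))
  · exact congrArg (fun t => neg (p.map t)) (Subtype.ext (map_eq_restrictNeg q ⟨x, hb.fst⟩))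

theorem restrictClass_injective :
    Function.Injective (restrictClass : LieExtendedCentroid Φ J.TKK → J.ExtendedCentroid) := by
  rintro ⟨p⟩ ⟨q⟩ h
  exact Quotient.sound (rel_of_restrict_rel (Quotient.exact h))

end Restriction

end TKK

/-! ### Extension of a permissible map of V to TKK(V) through its graph -/

namespace VHom

variable {U : J.Ideal} (g : J.VHom U)

/-- The graph of `g⁺`. -/
def graphPos : Submodule Φ (Vp × Vp) where
  carrier := {a | ∃ h : a.1 ∈ U.pos, g.gp ⟨a.1, h⟩ = a.2}
  zero_mem' := ⟨zero_mem _, map_zero g.gp⟩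
  add_mem' := by
    rintro a b ⟨h, e⟩ ⟨k, e'⟩
    exact ⟨add_mem h k, (map_add g.gp ⟨_, h⟩ ⟨_, k⟩).trans (congrArg₂ (· + ·) e e')⟩
  smul_mem' := by
    rintro c a ⟨h, e⟩
    exact ⟨U.pos.smul_mem c h, (_root_.map_smul g.gp c ⟨_, h⟩).trans (congrArg (c • ·) e)⟩

/-- The graph of `g⁻`. -/
def graphNeg : Submodule Φ (Vm × Vm) where
  carrier := {a | ∃ h : a.1 ∈ U.neg, g.gm ⟨a.1, h⟩ = a.2}
  zero_mem' := ⟨zero_mem _, map_zero g.gm⟩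
  add_mem' := by
    rintro a b ⟨h, e⟩ ⟨k, e'⟩
    exact ⟨add_mem h k, (map_add g.gm ⟨_, h⟩ ⟨_, k⟩).trans (congrArg₂ (· + ·) e e')⟩
  smul_mem' := by
    rintro c a ⟨h, e⟩
    exact ⟨U.neg.smul_mem c h, (_root_.map_smul g.gm c ⟨_, h⟩).trans (congrArg (c • ·) e)⟩

variable {g}

theorem graphPos_unique {u v w : Vp} (h : (u, v) ∈ g.graphPos) (k : (u, w) ∈ g.graphPos) :
    v = w := h.2.symm.trans k.2

theorem graphNeg_unique {u v w : Vm} (h : (u, v) ∈ g.graphNeg) (k : (u, w) ∈ g.graphNeg) :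
    v = w := h.2.symm.trans k.2

theorem graphPos_triple {u v : Vp} (h : (u, v) ∈ g.graphPos) (y : Vm) (x : Vp) :
    (J.Tp u y x, J.Tp v y x) ∈ g.graphPos := by
  obtain ⟨h, e⟩ := h
  dsimp only at h e
  subst e
  exact ⟨U.triple_right_pos x y h, g.triple_pos ⟨u, h⟩ y x⟩

theorem graphNeg_triple {u v : Vm} (h : (u, v) ∈ g.graphNeg) (y : Vp) (x : Vm) :
    (J.Tm u y x, J.Tm v y x) ∈ g.graphNeg := by
  obtain ⟨h, e⟩ := h
  dsimp only at h e
  subst e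
  exact ⟨U.triple_right_neg x y h, g.triple_neg ⟨u, h⟩ y x⟩

/-- Linearization of g(Q_x u) = Q_x g(u) in x. -/
theorem graphPos_triple_mid {u v : Vm} (h : (u, v) ∈ g.graphNeg) (x z : Vp) :
    (J.Tp x u z, J.Tp x v z) ∈ g.graphPos := by
  obtain ⟨h, e⟩ := h
  dsimp only at h e
  subst e
  have hQ : ∀ w, (J.Qp w u, J.Qp w (g.gm ⟨u, h⟩)) ∈ g.graphPos := fun w =>
    ⟨U.outer_pos w u h, g.outer_pos w ⟨u, h⟩⟩
  rw [jordanTriple_apply, jordanTriple_apply]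
  exact sub_mem (sub_mem (hQ _) (hQ _)) (hQ _)

theorem graphNeg_triple_mid {u v : Vp} (h : (u, v) ∈ g.graphPos) (x z : Vm) :
    (J.Tm x u z, J.Tm x v z) ∈ g.graphNeg := by
  obtain ⟨h, e⟩ := h
  dsimp only at h e
  subst e
  have hQ : ∀ w, (J.Qm w u, J.Qm w (g.gp ⟨u, h⟩)) ∈ g.graphNeg := fun w =>
    ⟨U.outer_neg w u h, g.outer_neg w ⟨u, h⟩⟩
  rw [jordanTriple_apply, jordanTriple_apply]
  exact sub_mem (sub_mem (hQ _) (hQ _)) (hQ _)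

/-- g commutes with the action of IDer V: on δ(x, y) this is the rule for {u, y, x}, by symmetry of
the triple product in its outer entries. -/
theorem graphPos_actp {u v : Vp} (h : (u, v) ∈ g.graphPos) (D : J.InnDer) :
    (J.actp D u, J.actp D v) ∈ g.graphPos := by
  refine innDer_induction (P := fun D => (J.actp D u, J.actp D v) ∈ g.graphPos) ?_ ?_ ?_ ?_ D
  · intro x y
    rw [actp_delta, actp_delta, jordanTriple_comm _ x, jordanTriple_comm _ x]
    exact graphPos_triple h y x
  · rw [map_zero]; exact zero_mem _
  · intro D E hD hE
    rw [map_add]; exact add_mem hD hE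
  · intro c D hD
    rw [_root_.map_smul]; exact Submodule.smul_mem _ c hD

theorem graphNeg_actm {u v : Vm} (h : (u, v) ∈ g.graphNeg) (D : J.InnDer) :
    (J.actm D u, J.actm D v) ∈ g.graphNeg := by
  refine innDer_induction (P := fun D => (J.actm D u, J.actm D v) ∈ g.graphNeg) ?_ ?_ ?_ ?_ D
  · intro x y
    rw [actm_delta, actm_delta, jordanTriple_comm _ y, jordanTriple_comm _ y]
    exact neg_mem (graphNeg_triple h x y)
  · rw [map_zero]; exact zero_mem _
  · intro D E hD hE
    rw [map_add]; exact add_mem hD hE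
  · intro c D hD
    rw [_root_.map_smul]; exact Submodule.smul_mem _ c hD

variable (g) in
/-- The graph of the extension of `g` to `TKK(V)`: `u + D + v ↦ g⁺(u) + E + g⁻(v)`, where
`E = g ∘ D`. -/
def graph : Submodule Φ (J.TKK × J.TKK) where
  carrier := {a | (TKK.pos a.1, TKK.pos a.2) ∈ g.graphPos ∧ (TKK.neg a.1, TKK.neg a.2) ∈ g.graphNeg ∧
    (∀ x, (J.actp (TKK.zer a.1) x, J.actp (TKK.zer a.2) x) ∈ g.graphPos) ∧
    ∀ y, (J.actm (TKK.zer a.1) y, J.actm (TKK.zer a.2) y) ∈ g.graphNeg}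
  zero_mem' := by
    simp only [Set.mem_ofPred_eq, Prod.fst_zero, Prod.snd_zero, map_zero, LinearMap.zero_apply]
    exact ⟨zero_mem _, zero_mem _, fun _ => zero_mem _, fun _ => zero_mem _⟩
  add_mem' := by
    rintro a b ⟨h1, h2, h3, h4⟩ ⟨k1, k2, k3, k4⟩
    simp only [Set.mem_ofPred_eq, Prod.fst_add, Prod.snd_add, map_add, LinearMap.add_apply]
    exact ⟨add_mem h1 k1, add_mem h2 k2, fun x => add_mem (h3 x) (k3 x),
      fun x => add_mem (h4 x) (k4 x)⟩
  smul_mem' := by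
    rintro c a ⟨h1, h2, h3, h4⟩
    simp only [Set.mem_ofPred_eq, Prod.smul_fst, Prod.smul_snd, _root_.map_smul,
      LinearMap.smul_apply]
    exact ⟨Submodule.smul_mem _ c h1, Submodule.smul_mem _ c h2,
      fun x => Submodule.smul_mem _ c (h3 x), fun x => Submodule.smul_mem _ c (h4 x)⟩

/-- In degree zero, E is forced on all of V by E = g ∘ D, and a derivation is determined by its
action on V. -/
theorem graph_unique {a b c : J.TKK} (h : (a, b) ∈ g.graph) (k : (a, c) ∈ g.graph) : b = c := by
  obtain ⟨h1, h2, h3, h4⟩ := h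
  obtain ⟨k1, k2, k3, k4⟩ := k
  exact TKK.ext (graphPos_unique h1 k1)
    (iDer_ext (fun x => graphPos_unique (h3 x) (k3 x)) fun x => graphNeg_unique (h4 x) (k4 x))
    (graphNeg_unique h2 k2)

/-- This single stability property makes the domain an ideal and the extended map commute with every
ad x. -/
theorem graph_lie {a b : J.TKK} (h : (a, b) ∈ g.graph) (x : J.TKK) :
    (⁅x, a⁆, ⁅x, b⁆) ∈ g.graph := by
  obtain ⟨h1, h2, h3, h4⟩ := h
  dsimp only at h1 h2 h3 h4
  refine ⟨?_, ?_, fun z => ?_, fun z => ?_⟩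
  · simp only [TKK.pos_lie]
    exact sub_mem (graphPos_actp h1 _) (h3 _)
  · simp only [TKK.neg_lie]
    exact sub_mem (graphNeg_actm h2 _) (h4 _)
  · simp only [TKK.zer_lie, map_add, map_sub, LinearMap.add_apply, LinearMap.sub_apply, actp_lie,
      actp_delta]
    -- Let D be the degree-zero part of x. The first two terms come from the commutator with D: g
    -- commutes with D, and the relation for a also applies at the vector Dz. The other two are
    -- δ(x⁺, a⁻)z and δ(a⁺, x⁻)z, with the entry from a in the middle and in the first slot.
    exact sub_mem (add_mem (sub_mem (graphPos_actp (h3 z) _) (h3 _)) (graphPos_triple_mid h2 _ _))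
      (graphPos_triple h1 _ _)
  · simp only [TKK.zer_lie, map_add, map_sub, LinearMap.add_apply, LinearMap.sub_apply, actm_lie,
      actm_delta]
    exact sub_mem (add_mem (sub_mem (graphNeg_actm (h4 z) _) (h4 _))
      (neg_mem (graphNeg_triple h2 _ _))) (neg_mem (graphNeg_triple_mid h1 _ _))

theorem inp_mem_graph (u : U.pos) : (TKK.inp J u, TKK.inp J (g.gp u)) ∈ g.graph := by
  refine ⟨⟨u.2, rfl⟩, zero_mem _, fun _ => ?_, fun _ => ?_⟩ <;>
    simp only [TKK.zer_inp, map_zero, LinearMap.zero_apply] <;> exact zero_mem _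

theorem inm_mem_graph (u : U.neg) : (TKK.inm J u, TKK.inm J (g.gm u)) ∈ g.graph := by
  refine ⟨zero_mem _, ⟨u.2, rfl⟩, fun _ => ?_, fun _ => ?_⟩ <;>
    simp only [TKK.zer_inm, map_zero, LinearMap.zero_apply] <;> exact zero_mem _

variable (g) in
/-- The domain of the extension of `g` to `TKK(V)`. -/
def extendDom : LieIdeal Φ J.TKK where
  carrier := {a | ∃ b, (a, b) ∈ g.graph}
  zero_mem' := ⟨0, zero_mem g.graph⟩
  add_mem' := fun ⟨b, hb⟩ ⟨c, hc⟩ => ⟨b + c, add_mem hb hc⟩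
  smul_mem' := fun r _ ⟨b, hb⟩ => ⟨r • b, g.graph.smul_mem r hb⟩
  lie_mem := fun {x _} ⟨b, hb⟩ => ⟨⁅x, b⁆, graph_lie hb x⟩

variable (g) in
/-- The extension of `g` to `TKK(V)`. -/
noncomputable def extendMap : g.extendDom →+ J.TKK :=
  -- The values are chosen arbitrarily in the relation; its single-valuedness forces additivity.
  AddMonoidHom.mk' (fun a => a.2.choose) fun a b =>
    graph_unique (a + b).2.choose_spec (add_mem a.2.choose_spec b.2.choose_spec)

theorem extendMap_eq {a b : J.TKK} (h : (a, b) ∈ g.graph) : g.extendMap ⟨a, b, h⟩ = b :=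
  graph_unique (Exists.choose_spec (p := fun c => (a, c) ∈ g.graph) ⟨b, h⟩) h

end VHom

/-- The extension of a permissible map of `V` to `TKK(V)`. -/
noncomputable def Permissible.extend [Invertible (2 : Φ)] [J.IsNondegenerate] (q : J.Permissible) :
    LiePermissible Φ J.TKK where
  dom := q.map.extendDom
  essential := TKK.isEssential_of_le q.essential (fun x hx => ⟨_, VHom.inp_mem_graph ⟨x, hx⟩⟩)
    (fun y hy => ⟨_, VHom.inm_mem_graph ⟨y, hy⟩⟩)
  map := q.map.extendMap
  map_lie x := by
    rintro ⟨a, b, h⟩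
    rw [VHom.extendMap_eq h]
    exact VHom.extendMap_eq (VHom.graph_lie h x)

/-! ### Surjectivity and the isomorphism -/

namespace TKK

variable [Invertible (2 : Φ)] [J.IsNondegenerate]

/-- Restricting the extension of g returns g, since the graph contains the pairs (u, g(u)) for u ∈
U^σ. -/
theorem restrictClass_surjective :
    Function.Surjective (restrictClass : LieExtendedCentroid Φ J.TKK → J.ExtendedCentroid) := by
  rintro ⟨q⟩
  refine ⟨LieExtendedCentroid.mk q.extend, Quotient.sound (Permissible.rel_of_agree
    (fun x _ hb => ?_) (fun y _ hb => ?_))⟩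
  · exact congrArg pos (VHom.extendMap_eq (VHom.inp_mem_graph (g := q.map) ⟨x, hb⟩))
  · exact congrArg neg (VHom.extendMap_eq (VHom.inm_mem_graph (g := q.map) ⟨y, hb⟩))

variable (J) in
/-- Restriction of permissible maps as an isomorphism `C(TKK(V)) ≃ C(V)`. -/
noncomputable def restrictEquiv : LieExtendedCentroid Φ J.TKK ≃+* J.ExtendedCentroid where
  __ := Equiv.ofBijective restrictClass ⟨restrictClass_injective (J := J), restrictClass_surjective⟩
  map_mul' := restrictClass_mul
  map_add' := restrictClass_add

end TKK

end JordanPair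

/-- For a nondegenerate Jordan pair `V` over `Φ ∋ 1/2`, restriction of permissible maps from `I` to
`I ∩ V` is a ring isomorphism `Ψ : C(TKK(V)) ≅ C(V)`. -/
theorem mainTheorem2 {Φ Vp Vm : Type*} [CommRing Φ] [Invertible (2 : Φ)]
    [AddCommGroup Vp] [Module Φ Vp] [AddCommGroup Vm] [Module Φ Vm]
    (J : JordanPair Φ Vp Vm) [J.IsNondegenerate] :
    ∃ Ψ : LieExtendedCentroid Φ J.TKK ≃+* J.ExtendedCentroid,
      ∀ p : LiePermissible Φ J.TKK, ∃ q : J.Permissible,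
        JordanPair.TKK.IsRestriction p q ∧
          Ψ (LieExtendedCentroid.mk p) = JordanPair.ExtendedCentroid.mk q :=
  ⟨JordanPair.TKK.restrictEquiv J, fun p =>
    -- The formula for Ψ holds definitionally: `Quotient.map` computes on the class of p.
    ⟨JordanPair.TKK.restrict p, JordanPair.TKK.isRestriction_restrict p, rfl⟩⟩
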